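/- Let $n\ge 1$ and let $\lambda_1>\lambda_2>\cdots>\lambda_n\ge 0$ be integers. The Gelfand--Cetlin polytope $\Delta\subset\mathbb{R}^{n(n+1)/2}$ is the convex hull of all integer arrays $\{\lambda^{(i)}_j\}_{1\le j\le i\le n}$ with $\lambda^{(n)}_j=\lambda_j$ for $1\le j\le n$ and $\lambda^{(i+1)}_j\ge\lambda^{(i)}_j\ge\lambda^{(i+1)}_{j+1}$ for $1\le j\le i\le n-1$. Let $V$ be the set of its vertices. For $0\le r\le n$ let $\binom{[n]}{r}$ be the set of sequences $I=[i_1<\cdots<i_r]$ in $\{1,\dots,n\}$, and for $1\le r\le n-1$ let $p_I$, $I\in\binom{[n]}{r}$, be the Plücker coordinates on $\mathbb{P}(\bigwedge^r\mathbb{C}^n)$. For $I=[i_1,\dots,i_l]$ and $J=[j_1,\dots,j_m]$ with $l\ge m$ put $I\vee J=[\max(i_1,j_1),\dots,\max(i_m,j_m)]$ and $I\wedge J=[\min(i_1,j_1),\dots,\min(i_m,j_m),i_{m+1},\dots,i_l]$; write $I\le J$ if $l\ge m$ and $i_a\le j_a$ for $1\le a\le m$. Let $X_0\subset\prod_{r=1}^{n-1}\mathbb{P}(\bigwedge^r\mathbb{C}^n)$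 be defined by the equations $p_Ip_J=p_{I\vee J}\,p_{I\wedge J}$ for all incomparable pairs $(I,J)$, and let $X=F\ell_n=\{V_1\subset\cdots\subset V_{n-1}\subset\mathbb{C}^n:\dim V_r=r\}$, embedded in the same product by the Plücker embedding. Put $b_r=\lambda_r-\lambda_{r+1}$ with $\lambda_{n+1}=0$. Give $p_I$, $I\in\binom{[n]}{r}$, the weight in $\mathbb{Z}^{n(n+1)/2}$ whose entry at $(i,j)$ is $1$ if $j\le r$ and $i_j\le i$, and $0$ otherwise, and set $p_{[1,\dots,n]}=1$. The monomials in the $p_I$ that contain exactly $b_r$ factors with $|I|=r$ for each $1\le r\le n$, with the lattice points of $\Delta$ as their weights, identify $X_0$ with the projective toric variety of $\Delta$ (embedded by the lattice points of $\Delta$). For $z\in V$, let $X_0(z)$ be the $0$-dimensional toric subvariety of $X_0$ that corresponds under this identification to the vertex $z$ of $\Delta$. Then: 1. for every $z\in V$, $X_0(z)$ is a single point; 2. for every vertex $z=\{\lambda^{(i)}_j\}\in V$, the point $X_0(z)$ lies on $F\ell_n$ if and only if for no $i,j$ with $1\le j\le i<i+2\le n$ do all the equalities $$\lambda_j^{(i)}=\lambda_{j+1}^{(i+1)}=\lambda_j^{(i+1)}=\lambda_{j+1}^{(i+2)}$$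 hold; 3. the vertices $z\in V$ for which no such quadruple equality holds are precisely the regular vertices of $\Delta$, that is, the vertices that lie in exactly $\frac{n(n-1)}{2}$ facets of $\Delta$. -/

import Mathlib

open scoped BigOperators

noncomputable section

namespace GelfandCetlin

/-! ### Gelfand-Cetlin patterns and the Gelfand-Cetlin polytope -/

/-- The index set `{(i, j) : 1 ≤ j ≤ i ≤ n}`; the pair `(i, j)` is the position of the entry
`λ_j^{(i)}`. -/
abbrev gcIndex (n : ℕ) : Finset (ℕ × ℕ) :=
  (Finset.Icc 1 n ×ˢ Finset.Icc 1 n).filter (fun p => p.2 ≤ p.1)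

/-- The position `(i, j)`. -/
def idx {n : ℕ} (i j : ℕ) (hj : 1 ≤ j) (hji : j ≤ i) (hin : i ≤ n) : gcIndex n :=
  ⟨(i, j), by simp only [Finset.mem_filter, Finset.mem_product, Finset.mem_Icc]; omega⟩

/-- `m` is an integer Gelfand-Cetlin pattern with top row `lam 1, …, lam n`. -/
def IsIntegerPattern (n : ℕ) (lam : ℕ → ℕ) (m : gcIndex n → ℤ) : Prop :=
  (∀ (j : ℕ) (h1 : 1 ≤ j) (hn : j ≤ n), m (idx n j h1 hn le_rfl) = (lam j : ℤ)) ∧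
  ∀ (i j : ℕ) (h1 : 1 ≤ j) (hji : j ≤ i) (hin : i + 1 ≤ n),
    m (idx i j h1 hji (by omega)) ≤ m (idx (i + 1) j h1 (by omega) hin) ∧
    m (idx (i + 1) (j + 1) (by omega) (by omega) hin) ≤ m (idx i j h1 hji (by omega))

/-- The inclusion of the lattice `ℤ^{n(n+1)/2}` in `ℝ^{n(n+1)/2}`. -/
def toReal {n : ℕ} (m : gcIndex n → ℤ) : gcIndex n → ℝ := fun p => (m p : ℝ)

/-- The Gelfand-Cetlin polytope: the convex hull of all integer Gelfand-Cetlin patterns. -/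
def polytope (n : ℕ) (lam : ℕ → ℕ) : Set (gcIndex n → ℝ) :=
  convexHull ℝ (toReal '' {m | IsIntegerPattern n lam m})

/-- The vertices of the polytope. -/
def vertices (n : ℕ) (lam : ℕ → ℕ) : Set (gcIndex n → ℝ) :=
  (polytope n lam).extremePoints ℝ

/-- The lattice points of the polytope. -/
abbrev LatticePoint (n : ℕ) (lam : ℕ → ℕ) : Type :=
  {m : gcIndex n → ℤ // toReal m ∈ polytope n lam}

/-- `F` is a facet of `P`: a nonempty face of codimension one. -/
def IsFacet {n : ℕ} (P F : Set (gcIndex n → ℝ)) : Prop :=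
  IsExposed ℝ P F ∧ F.Nonempty ∧
    Module.finrank ℝ (vectorSpan ℝ F) + 1 = Module.finrank ℝ (vectorSpan ℝ P)

/-- The regular vertices: those that lie in exactly `n (n - 1) / 2` facets. -/
def regularVertices (n : ℕ) (lam : ℕ → ℕ) : Set (gcIndex n → ℝ) :=
  {z ∈ vertices n lam |
    {F | IsFacet (polytope n lam) F ∧ z ∈ F}.encard = ((n * (n - 1) / 2 : ℕ) : ℕ∞)}

/-- The quadruple equality `λ_j^{(i)} = λ_{j+1}^{(i+1)} = λ_j^{(i+1)} = λ_{j+1}^{(i+2)}`. -/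
def QuadrupleEquality {n : ℕ} (z : gcIndex n → ℝ) (i j : ℕ)
    (h1 : 1 ≤ j) (hji : j ≤ i) (hin : i + 2 ≤ n) : Prop :=
  z (idx i j h1 hji (by omega)) = z (idx (i + 1) (j + 1) (by omega) (by omega) (by omega)) ∧
  z (idx (i + 1) (j + 1) (by omega) (by omega) (by omega)) =
    z (idx (i + 1) j h1 (by omega) (by omega)) ∧
  z (idx (i + 1) j h1 (by omega) (by omega)) =
    z (idx (i + 2) (j + 1) (by omega) (by omega) hin)

/-! ### Toric varieties of the polytope and of its faces -/

/-- The Zariski closure, in projective space, of the set of points with homogeneous coordinate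
vectors in `A`. -/
def zariskiClosure {ι : Type} (A : Set (ι → ℂ)) : Set (Projectivization ℂ (ι → ℂ)) :=
  {y | ∀ (f : MvPolynomial ι ℂ) (d : ℕ), f.IsHomogeneous d →
    (∀ a ∈ A, MvPolynomial.eval a f = 0) → MvPolynomial.eval y.rep f = 0}

/-- The character `χ^m` of the torus `(ℂˣ)^{n(n+1)/2}`. -/
def character {n : ℕ} (m : gcIndex n → ℤ) (t : gcIndex n → ℂˣ) : ℂ :=
  ∏ p, ((t p : ℂ)) ^ (m p)

open Classical in
/-- The toric subvariety of a face `F` of the polytope, in the projective space whose homogeneous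
coordinates are indexed by the lattice points of the polytope: the closure of the torus orbit of
the distinguished point of `F` (coordinates `1` at the lattice points of `F`, `0` elsewhere).
For `F` the whole polytope it is the projective toric variety of the polytope. -/
def toricSubvariety (n : ℕ) (lam : ℕ → ℕ) (F : Set (gcIndex n → ℝ)) :
    Set (Projectivization ℂ (LatticePoint n lam → ℂ)) :=
  zariskiClosure (Set.range fun (t : gcIndex n → ℂˣ) (m : LatticePoint n lam) =>
    if toReal m.1 ∈ F then character m.1 t else 0)

/-! ### The product of projective spaces, the flag variety and its toric degeneration -/

/-- The product of the projective spaces `ℙ(⋀^r ℂ^n)`, `1 ≤ r ≤ n - 1`. The homogeneous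
coordinates `p_I` of the factor `r` are indexed by the increasing sequences
`I = [i_1 < ⋯ < i_r]`; the value `I a : Fin n` stands for `i_{a+1} = I a + 1`. -/
abbrev PluckerSpace (n : ℕ) : Type :=
  (r : Set.Ioo 0 n) → Projectivization ℂ ((Fin r.1 ↪o Fin n) → ℂ)

/-- Complete flags `V_1 ⊆ ⋯ ⊆ V_{n-1} ⊆ ℂ^n`, `dim V_r = r`. -/
structure CompleteFlag (n : ℕ) where
  V : Set.Ioo 0 n → Submodule ℂ (Fin n → ℂ)
  mono : Monotone V
  finrank_eq : ∀ r, Module.finrank ℂ (V r) = r.1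

/-- The Plücker coordinates of `v_1 ∧ ⋯ ∧ v_r`. -/
def pluckerVector {n r : ℕ} (v : Fin r → Fin n → ℂ) : (Fin r ↪o Fin n) → ℂ :=
  fun I => Matrix.det (Matrix.of fun a b : Fin r => v a (I b))

/-- `y` is the Plücker point `⋀^r W` of the `r`-dimensional subspace `W`. -/
def IsPluckerPoint {n r : ℕ} (W : Submodule ℂ (Fin n → ℂ))
    (y : Projectivization ℂ ((Fin r ↪o Fin n) → ℂ)) : Prop :=
  ∃ (v : Module.Basis (Fin r) ℂ W) (h : pluckerVector (fun a => (v a : Fin n → ℂ)) ≠ 0),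
    y = Projectivization.mk ℂ (pluckerVector fun a => (v a : Fin n → ℂ)) h

/-- The complete flag variety `Fℓ_n`, as the image of the Plücker embedding. -/
def flagVariety (n : ℕ) : Set (PluckerSpace n) :=
  {x | ∃ V : CompleteFlag n, ∀ r, IsPluckerPoint (V.V r) (x r)}

/-- The partial order on positive paths: `π_I ≤ π_J` when `π_J` runs above `π_I`. Here `π_I` is
the lattice path that starts at the lower left corner, goes right exactly at the steps in `I`, and
goes up at the other steps. -/
def PathLE {n l m : ℕ} (I : Fin l ↪o Fin n) (J : Fin m ↪o Fin n) : Prop :=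
  ∃ h : m ≤ l, ∀ a : Fin m, I (Fin.castLE h a) ≤ J a

/-- `I ∨ J = {max(i_1, j_1), …, max(i_m, j_m)}`. -/
def join {n l m : ℕ} (h : m ≤ l) (I : Fin l ↪o Fin n) (J : Fin m ↪o Fin n) :
    Fin m ↪o Fin n :=
  OrderEmbedding.ofStrictMono (fun a => max (I (Fin.castLE h a)) (J a)) (by
    intro a b hab
    exact max_lt_max (I.strictMono (show (Fin.castLE h a).1 < (Fin.castLE h b).1 from hab)) (J.strictMono hab))

/-- `I ∧ J = {min(i_1, j_1), …, min(i_m, j_m), i_{m+1}, …, i_l}`. -/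
def meet {n l m : ℕ} (I : Fin l ↪o Fin n) (J : Fin m ↪o Fin n) :
    Fin l ↪o Fin n :=
  OrderEmbedding.ofStrictMono
    (fun a => if h : a.1 < m then min (I a) (J ⟨a.1, h⟩) else I a) (by
    intro a b hab
    have hI := I.strictMono hab
    have hab' : a.1 < b.1 := hab
    by_cases hb : b.1 < m
    · have ha : a.1 < m := by omega
      simp only [ha, hb, dif_pos]
      exact min_lt_min hI (J.strictMono hab)
    · by_cases ha : a.1 < m
      · simp only [ha, hb, dif_pos, dif_neg, not_false_eq_true]
        exact lt_of_le_of_lt (min_le_left _ _) hI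
      · simpa only [ha, hb, dif_neg, not_false_eq_true] using hI)

/-- The variety `X_0`, cut out in the product of projective spaces by the multi-homogeneous
equations `p_I p_J = p_{I ∨ J} p_{I ∧ J}`, one for each incomparable pair. -/
def X0 (n : ℕ) : Set (PluckerSpace n) :=
  {x | ∀ (l m : Set.Ioo 0 n) (h : m.1 ≤ l.1) (I : Fin l.1 ↪o Fin n) (J : Fin m.1 ↪o Fin n),
    ¬ PathLE I J → ¬ PathLE J I →
      (x l).rep I * (x m).rep J = (x m).rep (join h I J) * (x l).rep (meet I J)}

/-! ### The identification of `X_0` with the toric variety of the polytope -/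

/-- `b_j = λ_j - λ_{j+1}` for `1 ≤ j ≤ n`, where `λ_{n+1} = 0`. -/
def bdiff (n : ℕ) (lam : ℕ → ℕ) (j : ℕ) : ℕ :=
  if j < n then lam j - lam (j + 1) else lam j

/-- The vector `β_I`: its entry at `(i, j)` is `1` if the box `(i, j)` is right above the path
`π_I`, that is, if `j ≤ r` and `i = i_j`, and `0` otherwise. -/
def beta {n r : ℕ} (I : Fin r ↪o Fin n) : gcIndex n → ℤ :=
  fun p => if ∃ a : Fin r, a.1 + 1 = p.1.2 ∧ (I a).1 + 1 = p.1.1 then 1 else 0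

/-- The bijection `φ` of `ℤ^{n(n+1)/2}`: `λ_j^{(i)} = b_{i,j} + b_{i-1,j} + ⋯ + b_{j,j}`. -/
def phi {n : ℕ} (b : gcIndex n → ℤ) : gcIndex n → ℤ :=
  fun p => ∑ q, if q.1.2 = p.1.2 ∧ q.1.1 ≤ p.1.1 then b q else 0

/-- A choice of `b_r` sequences of length `r` for every `1 ≤ r ≤ n - 1`; it is the index of a
monomial of multidegree `(b_1, …, b_{n-1})` in the coordinates `p_I`. (The only sequence of length
`n` is `[1, …, n]`, and its coordinate on the one-point space `ℙ(⋀^n ℂ^n)` is `1`.) -/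
abbrev MonomialIndex (n : ℕ) (lam : ℕ → ℕ) : Type :=
  (r : Set.Ioo 0 n) → Fin (bdiff n lam r.1) → (Fin r.1 ↪o Fin n)

/-- The monomial `∏ p_I`. -/
def monomialValue {n : ℕ} {lam : ℕ → ℕ} (s : MonomialIndex n lam) (x : PluckerSpace n) : ℂ :=
  ∏ r, ∏ a, (x r).rep (s r a)

/-- The weight `φ(∑ β_I)` of a monomial, where the sum includes the sequence `[1, …, n]` with
multiplicity `b_n`. -/
def monomialWeight {n : ℕ} {lam : ℕ → ℕ} (s : MonomialIndex n lam) : gcIndex n → ℤ :=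
  phi ((∑ r, ∑ a, beta (s r a)) + bdiff n lam n • beta (RelEmbedding.refl _ : Fin n ↪o Fin n))

/-- `y` is the image of `x` under the projective embedding of `X_0` by the monomials of multidegree
`(b_1, …, b_n)`: the coordinate of `y` at a lattice point `m` of the polytope is the value at `x`
of the monomials of weight `m`. The common factor `c` accounts for the choice of homogeneous
coordinates. -/
def IsImage {n : ℕ} {lam : ℕ → ℕ} (x : PluckerSpace n)
    (y : Projectivization ℂ (LatticePoint n lam → ℂ)) : Prop :=
  ∃ c : ℂ, c ≠ 0 ∧ ∀ (s : MonomialIndex n lam) (m : LatticePoint n lam),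
    monomialWeight s = m.1 → monomialValue s x = c * y.rep m

/-- `X_0(F)`: the toric subvariety of `X_0` that corresponds to the face `F` of the polytope. -/
def X0Face (n : ℕ) (lam : ℕ → ℕ) (F : Set (gcIndex n → ℝ)) : Set (PluckerSpace n) :=
  {x ∈ X0 n | ∃ y ∈ toricSubvariety n lam F, IsImage x y}

/-- `V^X` for `X = Fℓ_n`: the vertices `z` for which the point `X_0(z)` lies on `X`. -/
def verticesOnFlag (n : ℕ) (lam : ℕ → ℕ) : Set (gcIndex n → ℝ) :=
  {z ∈ vertices n lam | ∃ x, X0Face n lam {z} = {x} ∧ x ∈ flagVariety n}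

end GelfandCetlin

end

noncomputable section

namespace GelfandCetlin

/-! All three claims are reduced to one condition on a vertex `z`, `StrictRows z`: every row of `z`
is strictly decreasing. Interlacing makes this the same as the absence of quadruple equalities
(`strictRows_iff`).

Polytope. The real patterns form a compact convex set. At an extreme point every entry below the top
row equals one of its two upper neighbours (`ent_eq_or_eq`); otherwise the entries of the same value
in its row and below could be shifted together in both directions. So the entries of a vertex are
among the `lam c`, vertices are integral, and the hull of the integer patterns is the set of all
patterns.

Regularity. The facets correspond bijectively to the edges, each facet being the face where one
interlacing inequality is tight. At a vertex each of the n(n-1)/2 positions below the top row has a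
tight edge, and it has two exactly when its upper neighbours coincide. Thus the number of facets
through `z` is n(n-1)/2 if and only if the rows are strict.

The point of a vertex. Cutting `z` at the level `lam r` gives a 0-1 pattern, the weight of a
sequence I_r (`patternSeq`), and `z` is the sum of the b_r-fold multiples of these weights. An
exchange of factors between monomials moves weights by `v` and `-v`, so extremality of `z` makes the
monomial of weight `z` unique. As b_r > 0 for r < n, X_0(z) is the single point whose only nonzero
coordinates are the p_{I_r} (`X0Face_vertex`).

The flag variety. A tuple of coordinate points is a flag if and only if the index sets are nested
(`mem_flagVariety_iff`), and for a vertex the I_r are nested if and only if the rows are strict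
(`nestedRows_of_strictRows`, `strictRows_of_nestedRows`). -/

open Filter Topology

variable {n : ℕ} {lam : ℕ → ℕ}

/-! ### The polytope as a set of real patterns -/

/-- The entry at `(i, j)`, as a continuous linear functional (zero off the index set). -/
def ent (i j : ℕ) : (gcIndex n → ℝ) →L[ℝ] ℝ :=
  if h : (i, j) ∈ gcIndex n then ContinuousLinearMap.proj (⟨(i, j), h⟩ : gcIndex n) else 0

lemma mem_gcIndex {i j : ℕ} : (i, j) ∈ gcIndex n ↔ 1 ≤ j ∧ j ≤ i ∧ i ≤ n := by
  simp only [Finset.mem_filter, Finset.mem_product, Finset.mem_Icc]; omega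

lemma ent_apply (x : gcIndex n → ℝ) (p : gcIndex n) : ent p.1.1 p.1.2 x = x p := by
  have h : (p.1.1, p.1.2) ∈ gcIndex n := p.2
  rw [ent, dif_pos h]; rfl

lemma apply_idx (x : gcIndex n → ℝ) {i j : ℕ} (h1 : 1 ≤ j) (h2 : j ≤ i) (h3 : i ≤ n) :
    x (idx i j h1 h2 h3) = ent i j x := (ent_apply x (idx i j h1 h2 h3)).symm

lemma ext_ent {x y : gcIndex n → ℝ}
    (h : ∀ i j, 1 ≤ j → j ≤ i → i ≤ n → ent i j x = ent i j y) : x = y := by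
  funext p
  obtain ⟨h1, h2, h3⟩ := mem_gcIndex.1 (show (p.1.1, p.1.2) ∈ gcIndex n from p.2)
  rw [← ent_apply x, ← ent_apply y, h _ _ h1 h2 h3]

/-- The edges: an edge `((i, j), true)` joins `(i, j)` to `(i + 1, j)`, and an edge
`((i, j), false)` joins it to `(i + 1, j + 1)`. -/
def edges (n : ℕ) : Finset ((ℕ × ℕ) × Bool) := gcIndex (n - 1) ×ˢ Finset.univ

lemma mem_edges {i j : ℕ} {b : Bool} :
    ((i, j), b) ∈ edges n ↔ 1 ≤ j ∧ j ≤ i ∧ i + 1 ≤ n := by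
  rw [edges, Finset.mem_product, mem_gcIndex]
  simp only [Finset.mem_univ, and_true]; omega

/-- The slack of the inequality that belongs to an edge. -/
def gap (e : (ℕ × ℕ) × Bool) : (gcIndex n → ℝ) →L[ℝ] ℝ :=
  if e.2 then ent (e.1.1 + 1) e.1.2 - ent e.1.1 e.1.2
  else ent e.1.1 e.1.2 - ent (e.1.1 + 1) (e.1.2 + 1)

lemma gap_true (i j : ℕ) (x : gcIndex n → ℝ) :
    gap ((i, j), true) x = ent (i + 1) j x - ent i j x := by simp [gap]

lemma gap_false (i j : ℕ) (x : gcIndex n → ℝ) :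
    gap ((i, j), false) x = ent i j x - ent (i + 1) (j + 1) x := by simp [gap]

/-- The real Gelfand-Cetlin patterns. -/
def patterns (n : ℕ) (lam : ℕ → ℕ) : Set (gcIndex n → ℝ) :=
  {x | (∀ j, 1 ≤ j → j ≤ n → ent n j x = lam j) ∧ ∀ e ∈ edges n, 0 ≤ gap e x}

lemma toReal_mem_patterns {m : gcIndex n → ℤ} :
    toReal m ∈ patterns n lam ↔ IsIntegerPattern n lam m := by
  have key : ∀ i j h1 h2 h3, ent i j (toReal m) = ((m (idx i j h1 h2 h3) : ℤ) : ℝ) :=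
    fun i j h1 h2 h3 => (apply_idx (toReal m) h1 h2 h3).symm
  constructor
  · rintro ⟨ht, hg⟩
    refine ⟨fun j h1 hn => ?_, fun i j h1 h2 h3 => ⟨?_, ?_⟩⟩
    · have := ht j h1 hn
      rw [key n j h1 hn le_rfl] at this
      exact_mod_cast this
    · have := hg ((i, j), true) (mem_edges.2 ⟨h1, h2, h3⟩)
      rw [gap_true, key i j h1 h2 (by omega), key (i + 1) j h1 (by omega) h3] at this
      exact_mod_cast sub_nonneg.1 this
    · have := hg ((i, j), false) (mem_edges.2 ⟨h1, h2, h3⟩)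
      rw [gap_false, key i j h1 h2 (by omega),
        key (i + 1) (j + 1) (by omega) (by omega) h3] at this
      exact_mod_cast sub_nonneg.1 this
  · rintro ⟨ht, hg⟩
    refine ⟨fun j h1 hn => ?_, ?_⟩
    · rw [key n j h1 hn le_rfl, ht j h1 hn]; simp
    · rintro ⟨⟨i, j⟩, b⟩ he
      obtain ⟨h1, h2, h3⟩ := mem_edges.1 he
      cases b
      · rw [gap_false, key i j h1 h2 (by omega),
          key (i + 1) (j + 1) (by omega) (by omega) h3, sub_nonneg]
        exact_mod_cast (hg i j h1 h2 h3).2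
      · rw [gap_true, key i j h1 h2 (by omega), key (i + 1) j h1 (by omega) h3, sub_nonneg]
        exact_mod_cast (hg i j h1 h2 h3).1

section Order

variable {x : gcIndex n → ℝ} (hx : x ∈ patterns n lam)
include hx

lemma ent_le_left {i j : ℕ} (h1 : 1 ≤ j) (h2 : j ≤ i) (h3 : i + 1 ≤ n) :
    ent i j x ≤ ent (i + 1) j x := by
  have := hx.2 ((i, j), true) (mem_edges.2 ⟨h1, h2, h3⟩)
  rwa [gap_true, sub_nonneg] at this

lemma right_le_ent {i j : ℕ} (h1 : 1 ≤ j) (h2 : j ≤ i) (h3 : i + 1 ≤ n) :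
    ent (i + 1) (j + 1) x ≤ ent i j x := by
  have := hx.2 ((i, j), false) (mem_edges.2 ⟨h1, h2, h3⟩)
  rwa [gap_false, sub_nonneg] at this

lemma ent_mono {i i' j : ℕ} (h1 : 1 ≤ j) (h2 : j ≤ i) (h : i ≤ i') (h3 : i' ≤ n) :
    ent i j x ≤ ent i' j x := by
  induction i', h using Nat.le_induction with
  | base => exact le_rfl
  | succ k hk ih => exact (ih (by omega)).trans (ent_le_left hx h1 (by omega) h3)

lemma ent_diag {i j k : ℕ} (h1 : 1 ≤ j) (h2 : j ≤ i) (h3 : i + k ≤ n) :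
    ent (i + k) (j + k) x ≤ ent i j x := by
  induction k with
  | zero => exact le_rfl
  | succ k ih =>
    exact (right_le_ent hx (i := i + k) (j := j + k) (by omega) (by omega) h3).trans
      (ih (by omega))

lemma ent_anti {i j j' : ℕ} (h1 : 1 ≤ j) (h : j ≤ j') (h2 : j' ≤ i) (h3 : i ≤ n) :
    ent i j' x ≤ ent i j x := by
  induction j', h using Nat.le_induction with
  | base => exact le_rfl
  | succ k hk ih =>
    refine le_trans ?_ (ih (by omega))
    obtain ⟨i, rfl⟩ : ∃ i', i = i' + 1 := ⟨i - 1, by omega⟩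
    exact (right_le_ent hx (by omega) (by omega) h3).trans
      (ent_le_left hx (by omega) (by omega) h3)

lemma ent_le_top {i j : ℕ} (h1 : 1 ≤ j) (h2 : j ≤ i) (h3 : i ≤ n) : ent i j x ≤ lam j := by
  rw [← hx.1 j h1 (by omega)]
  exact ent_mono hx h1 h2 h3 le_rfl

end Order

lemma lam_lt (hlam : ∀ j : ℕ, 1 ≤ j → j < n → lam (j + 1) < lam j) {j k : ℕ} (h1 : 1 ≤ j)
    (h : j < k) (hk : k ≤ n) : lam k < lam j := by
  induction k, h using Nat.le_induction with
  | base => exact hlam j h1 (by omega)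
  | succ k hk' ih => exact (hlam k (by omega) (by omega)).trans (ih (by omega))

lemma lam_le (hlam : ∀ j : ℕ, 1 ≤ j → j < n → lam (j + 1) < lam j) {j k : ℕ} (h1 : 1 ≤ j)
    (h : j ≤ k) (hk : k ≤ n) : lam k ≤ lam j := by
  rcases h.eq_or_lt with rfl | h
  · exact le_rfl
  · exact (lam_lt hlam h1 h hk).le

lemma lam_le_ent (hlam : ∀ j : ℕ, 1 ≤ j → j < n → lam (j + 1) < lam j) {x : gcIndex n → ℝ}
    (hx : x ∈ patterns n lam) {i j : ℕ} (h1 : 1 ≤ j) (h2 : j ≤ i) (h3 : i ≤ n) :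
    (lam n : ℝ) ≤ ent i j x := by
  have h := ent_diag hx (k := n - i) h1 h2 (by omega)
  rw [show i + (n - i) = n by omega, hx.1 _ (by omega) (by omega)] at h
  refine le_trans ?_ h
  exact_mod_cast lam_le hlam (by omega) (by omega) le_rfl

/-! ### Convexity, compactness and finiteness. -/

lemma convex_patterns : Convex ℝ (patterns n lam) := by
  intro x hx y hy a b ha hb hab
  refine ⟨fun j h1 h2 => ?_, fun e he => ?_⟩
  · rw [map_add, map_smul, map_smul, hx.1 j h1 h2, hy.1 j h1 h2, ← add_smul, hab, one_smul]
  · rw [map_add, map_smul, map_smul, smul_eq_mul, smul_eq_mul]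
    exact add_nonneg (mul_nonneg ha (hx.2 e he)) (mul_nonneg hb (hy.2 e he))

lemma isCompact_patterns (hlam : ∀ j : ℕ, 1 ≤ j → j < n → lam (j + 1) < lam j) :
    IsCompact (patterns n lam) := by
  have hc : IsClosed (patterns n lam) := by
    have : patterns n lam = (⋂ j, ⋂ (_ : 1 ≤ j), ⋂ (_ : j ≤ n), {x | ent n j x = (lam j : ℝ)}) ∩
        ⋂ e ∈ edges n, {x | 0 ≤ gap e x} := by
      ext x; simp [patterns]
    rw [this]
    refine IsClosed.inter ?_ ?_
    · exact isClosed_iInter fun j => isClosed_iInter fun _ => isClosed_iInter fun _ =>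
        isClosed_eq (ent n j).continuous continuous_const
    · exact isClosed_iInter fun e => isClosed_iInter fun _ =>
        isClosed_le continuous_const (gap e).continuous
  refine IsCompact.of_isClosed_subset
    (isCompact_Icc (a := fun _ => (lam n : ℝ)) (b := fun _ => (lam 1 : ℝ))) hc ?_
  intro x hx
  refine ⟨fun p => ?_, fun p => ?_⟩ <;>
  · obtain ⟨h1, h2, h3⟩ := mem_gcIndex.1 (show (p.1.1, p.1.2) ∈ gcIndex n from p.2)
    rw [← ent_apply x p]
    first
    | exact lam_le_ent hlam hx h1 h2 h3
    | exact (ent_le_top hx h1 h2 h3).trans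
        (Nat.cast_le.2 (lam_le hlam le_rfl h1 (by omega)))

lemma finite_integerPatterns (hlam : ∀ j : ℕ, 1 ≤ j → j < n → lam (j + 1) < lam j) :
    {m | IsIntegerPattern n lam m}.Finite := by
  refine (Set.finite_Icc (fun _ : gcIndex n => (lam n : ℤ)) (fun _ => (lam 1 : ℤ))).subset ?_
  intro m hm
  have hx := toReal_mem_patterns.2 hm
  refine ⟨fun p => ?_, fun p => ?_⟩ <;>
  · obtain ⟨h1, h2, h3⟩ := mem_gcIndex.1 (show (p.1.1, p.1.2) ∈ gcIndex n from p.2)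
    have ha := lam_le_ent hlam hx h1 h2 h3
    have hb := (ent_le_top hx h1 h2 h3).trans
      (show (lam _ : ℝ) ≤ lam 1 by exact_mod_cast lam_le hlam le_rfl h1 (by omega))
    rw [ent_apply] at ha hb
    simp only [toReal] at ha hb
    first
    | exact_mod_cast ha
    | exact_mod_cast hb

/-- A pattern can be moved a little in every direction that respects its top row and its tight
inequalities. -/
lemma eventually_mem_patterns {x v : gcIndex n → ℝ} (hx : x ∈ patterns n lam)
    (hv : ∀ j, 1 ≤ j → j ≤ n → ent n j v = 0)
    (hg : ∀ e ∈ edges n, gap e x = 0 → gap e v = 0) :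
    ∀ᶠ ε : ℝ in 𝓝 0, x + ε • v ∈ patterns n lam := by
  have h : ∀ᶠ ε : ℝ in 𝓝 0, ∀ e ∈ edges n, 0 ≤ gap e (x + ε • v) := by
    rw [Filter.eventually_all_finset]
    intro e he
    by_cases h0 : gap e x = 0
    · refine Eventually.of_forall fun ε => ?_
      rw [map_add, map_smul, hg e he h0, h0]; simp
    · have hpos : 0 < gap e x := lt_of_le_of_ne (hx.2 e he) (Ne.symm h0)
      have hcont : Continuous fun ε : ℝ => gap e (x + ε • v) := by fun_prop
      have : Tendsto (fun ε : ℝ => gap e (x + ε • v)) (𝓝 0) (𝓝 (gap e x)) := by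
        have := hcont.tendsto 0
        simpa using this
      exact (this.eventually (lt_mem_nhds hpos)).mono fun _ h => h.le
  filter_upwards [h] with ε hε
  refine ⟨fun j h1 h2 => ?_, hε⟩
  rw [map_add, map_smul, hv j h1 h2, hx.1 j h1 h2]; simp

lemma exists_pos_mem_patterns {x v : gcIndex n → ℝ} (hx : x ∈ patterns n lam)
    (hv : ∀ j, 1 ≤ j → j ≤ n → ent n j v = 0)
    (hg : ∀ e ∈ edges n, gap e x = 0 → gap e v = 0) :
    ∃ ε : ℝ, 0 < ε ∧ x + ε • v ∈ patterns n lam ∧ x - ε • v ∈ patterns n lam := by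
  have h1 := eventually_mem_patterns hx hv hg
  have h2 : ∀ᶠ ε : ℝ in 𝓝 0, x + (-ε) • v ∈ patterns n lam := by
    have : Tendsto (fun ε : ℝ => -ε) (𝓝 0) (𝓝 0) := by
      simpa using (continuous_neg (G := ℝ)).tendsto 0
    exact this.eventually h1
  have h3 : ∀ᶠ ε : ℝ in 𝓝[>] 0, 0 < ε := self_mem_nhdsWithin
  obtain ⟨ε, hε, ha, hb⟩ :=
    (h3.and ((h1.and h2).filter_mono nhdsWithin_le_nhds)).exists
  refine ⟨ε, hε, ha, ?_⟩
  rwa [neg_smul, ← sub_eq_add_neg] at hb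

/-- Otherwise `x` would be the midpoint of a nontrivial segment. This is the form in which
extremality enters all the exchange arguments. -/
lemma eq_zero_of_add_sub_mem {x v : gcIndex n → ℝ} (hx : x ∈ (patterns n lam).extremePoints ℝ)
    (h1 : x + v ∈ patterns n lam) (h2 : x - v ∈ patterns n lam) : v = 0 := by
  have hmid : x ∈ openSegment ℝ (x + v) (x - v) :=
    ⟨1 / 2, 1 / 2, by norm_num, by norm_num, by norm_num, by
      rw [← smul_add, add_add_sub_cancel, ← two_smul ℝ x, smul_smul]; norm_num⟩
  simpa using hx.2 h1 h2 hmid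

lemma eq_zero_of_extreme {x v : gcIndex n → ℝ} (hx : x ∈ (patterns n lam).extremePoints ℝ)
    (hv : ∀ j, 1 ≤ j → j ≤ n → ent n j v = 0)
    (hg : ∀ e ∈ edges n, gap e x = 0 → gap e v = 0) : v = 0 := by
  obtain ⟨ε, hε, h1, h2⟩ := exists_pos_mem_patterns hx.1 hv hg
  exact (smul_eq_zero.1 (eq_zero_of_add_sub_mem hx h1 h2)).resolve_left hε.ne'

/-- Every entry of a vertex below the top row equals one of its two upper neighbours. -/
lemma ent_eq_or_eq {z : gcIndex n → ℝ} (hz : z ∈ (patterns n lam).extremePoints ℝ) {i j : ℕ}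
    (h1 : 1 ≤ j) (h2 : j ≤ i) (h3 : i + 1 ≤ n) :
    ent i j z = ent (i + 1) j z ∨ ent i j z = ent (i + 1) (j + 1) z := by
  by_contra! hne
  have hl : ent i j z < ent (i + 1) j z := lt_of_le_of_ne (ent_le_left hz.1 h1 h2 h3) hne.1
  have hr : ent (i + 1) (j + 1) z < ent i j z :=
    lt_of_le_of_ne (right_le_ent hz.1 h1 h2 h3) (Ne.symm hne.2)
  classical
  -- The direction shifts together all entries in rows up to `i` that share the value of `(i, j)`. A
  -- tight edge joins equal values, so `v` could change along it only between rows `i` and `i + 1`;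
  -- by `hrow` that concerns `(i, j)` alone, whose two edges are not tight.
  let v : gcIndex n → ℝ := fun p => if p.1.1 ≤ i ∧ z p = ent i j z then 1 else 0
  have hvent : ∀ a b, 1 ≤ b → b ≤ a → a ≤ n →
      ent a b v = if a ≤ i ∧ ent a b z = ent i j z then 1 else 0 := by
    intro a b hb1 hb2 hb3
    rw [← apply_idx v hb1 hb2 hb3, ← apply_idx z hb1 hb2 hb3]
    rfl
  have hrow : ∀ b, 1 ≤ b → b ≤ i → ent i b z = ent i j z → b = j := by
    intro b hb1 hb2 hb
    rcases lt_trichotomy b j with h | h | h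
    · have e1 := right_le_ent hz.1 hb1 hb2 h3
      have e2 := ent_anti hz.1 (i := i + 1) (j := b + 1) (j' := j) (by omega) (by omega)
        (by omega) h3
      linarith
    · exact h
    · have e1 := ent_le_left hz.1 hb1 hb2 h3
      have e2 := ent_anti hz.1 (i := i + 1) (j := j + 1) (j' := b) (by omega) (by omega)
        (by omega) h3
      linarith
  have hv0 : v = 0 := by
    refine eq_zero_of_extreme hz (fun b hb1 hb2 => ?_) ?_
    · rw [hvent n b hb1 hb2 le_rfl, if_neg (by omega)]
    · rintro ⟨⟨a, b⟩, c⟩ he h0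
      obtain ⟨hb1, hb2, hb3⟩ := mem_edges.1 he
      cases c
      · rw [gap_false, sub_eq_zero] at h0 ⊢
        rw [hvent a b hb1 hb2 (by omega), hvent (a + 1) (b + 1) (by omega) (by omega) hb3, ← h0]
        by_cases hai : a + 1 ≤ i
        · simp [hai, (by omega : a ≤ i)]
        · by_cases hv : ent a b z = ent i j z
          · by_cases ha : a = i
            · subst ha
              obtain rfl := hrow b hb1 hb2 hv
              exact absurd h0 hr.ne'
            · rw [if_neg (by omega), if_neg (by omega)]
          · simp [hv]
      · rw [gap_true, sub_eq_zero] at h0 ⊢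
        rw [hvent a b hb1 hb2 (by omega), hvent (a + 1) b (by omega) (by omega) hb3, h0]
        by_cases hai : a + 1 ≤ i
        · simp [hai, (by omega : a ≤ i)]
        · by_cases hv : ent a b z = ent i j z
          · by_cases ha : a = i
            · subst ha
              obtain rfl := hrow b hb1 hb2 hv
              exact absurd h0 hl.ne'
            · rw [if_neg (by omega), if_neg (by omega)]
          · simp [hv]
  have h := hvent i j h1 h2 (by omega)
  rw [hv0, if_pos ⟨le_rfl, rfl⟩, map_zero] at h
  exact zero_ne_one h

/-- Every entry of a vertex is an entry of the top row. -/
lemma exists_ent_eq_lam {z : gcIndex n → ℝ} (hz : z ∈ (patterns n lam).extremePoints ℝ) {i j : ℕ}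
    (h1 : 1 ≤ j) (h2 : j ≤ i) (h3 : i ≤ n) : ∃ c, j ≤ c ∧ c ≤ n ∧ ent i j z = lam c := by
  induction h3 using Nat.decreasingInduction generalizing j with
  | self => exact ⟨j, le_rfl, h2, hz.1.1 j h1 h2⟩
  | of_succ i hi ih =>
    rcases ent_eq_or_eq hz h1 h2 hi with h | h
    · rw [h]; exact ih h1 (by omega)
    · rw [h]
      obtain ⟨c, hc, hc'⟩ := ih (j := j + 1) (by omega) (by omega)
      exact ⟨c, by omega, hc'⟩

lemma exists_toReal_eq {z : gcIndex n → ℝ} (hz : z ∈ (patterns n lam).extremePoints ℝ) :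
    ∃ m, toReal m = z := by
  have : ∀ p, ∃ k : ℤ, (k : ℝ) = z p := by
    intro p
    obtain ⟨h1, h2, h3⟩ := mem_gcIndex.1 (show (p.1.1, p.1.2) ∈ gcIndex n from p.2)
    obtain ⟨c, -, -, hc⟩ := exists_ent_eq_lam hz h1 h2 h3
    rw [ent_apply] at hc
    exact ⟨lam c, by rw [hc]; simp⟩
  choose m hm using this
  exact ⟨m, funext hm⟩

/-- By Krein-Milman the patterns are the closed hull of their extreme points, which are integral;
the hull of the finitely many integer patterns is already closed. -/
theorem polytope_eq_patterns (hlam : ∀ j : ℕ, 1 ≤ j → j < n → lam (j + 1) < lam j) :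
    polytope n lam = patterns n lam := by
  refine Set.Subset.antisymm (convexHull_min ?_ convex_patterns) ?_
  · rintro _ ⟨m, hm, rfl⟩
    exact toReal_mem_patterns.2 hm
  · have hcl : IsClosed (polytope n lam) :=
      (((finite_integerPatterns hlam).image toReal).isCompact_convexHull ℝ).isClosed
    rw [← closure_convexHull_extremePoints (isCompact_patterns hlam) convex_patterns]
    refine closure_minimal (convexHull_mono ?_) hcl
    intro z hz
    obtain ⟨m, rfl⟩ := exists_toReal_eq hz
    exact ⟨m, toReal_mem_patterns.1 hz.1, rfl⟩

theorem vertices_eq (hlam : ∀ j : ℕ, 1 ≤ j → j < n → lam (j + 1) < lam j) :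
    vertices n lam = (patterns n lam).extremePoints ℝ := by
  rw [vertices, polytope_eq_patterns hlam]

/-- All rows are strictly decreasing. -/
def StrictRows (z : gcIndex n → ℝ) : Prop :=
  ∀ i j, 1 ≤ j → j + 1 ≤ i → i ≤ n → ent i (j + 1) z < ent i j z

/-- A pattern has no quadruple equality if and only if its rows are strictly decreasing. -/
lemma strictRows_iff (hlam : ∀ j : ℕ, 1 ≤ j → j < n → lam (j + 1) < lam j) {z : gcIndex n → ℝ}
    (hz : z ∈ patterns n lam) :
    StrictRows z ↔ ∀ (i j : ℕ) (h1 : 1 ≤ j) (hji : j ≤ i) (hin : i + 2 ≤ n),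
      ¬ QuadrupleEquality z i j h1 hji hin := by
  constructor
  · rintro h i j h1 hji hin ⟨-, h', -⟩
    simp only [apply_idx] at h'
    exact (h (i + 1) j h1 (by omega) (by omega)).ne h'
  · intro h i j h1 h2 h3
    refine lt_of_le_of_ne (ent_anti hz h1 (by omega) h2 h3) fun heq => ?_
    rcases h3.eq_or_lt with rfl | h3
    · rw [hz.1 _ (by omega) h2, hz.1 _ h1 (by omega)] at heq
      exact (hlam j h1 (by omega)).ne (by exact_mod_cast heq)
    · obtain ⟨i, rfl⟩ : ∃ i', i = i' + 1 := ⟨i - 1, by omega⟩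
      -- Two equal neighbours in row `i + 1` squeeze the entry below them and the entry above them
      -- to the same value.
      refine h i j h1 (by omega) h3 ?_
      simp only [QuadrupleEquality, apply_idx]
      have a1 := ent_le_left hz h1 (by omega : j ≤ i) (by omega)
      have a2 := right_le_ent hz h1 (by omega : j ≤ i) (by omega)
      have a3 := ent_le_left hz (i := i + 1) (j := j + 1) (by omega) (by omega) (by omega)
      have a4 := right_le_ent hz (i := i + 1) (j := j) (by omega) (by omega) (by omega)
      refine ⟨?_, heq, ?_⟩ <;> linarith

/-! ### Facets -/

/-- The face of the polytope on which the inequalities of the edges in `S` are tight. -/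
def face (n : ℕ) (lam : ℕ → ℕ) (S : Set ((ℕ × ℕ) × Bool)) : Set (gcIndex n → ℝ) :=
  {x ∈ patterns n lam | ∀ e ∈ S, gap e x = 0}

/-- The direction of the affine hull of `face n lam S`. -/
def faceDirection (n : ℕ) (S : Set ((ℕ × ℕ) × Bool)) : Submodule ℝ (gcIndex n → ℝ) where
  carrier := {v | (∀ j, 1 ≤ j → j ≤ n → ent n j v = 0) ∧ ∀ e ∈ S, gap e v = 0}
  zero_mem' := ⟨fun j _ _ => map_zero _, fun e _ => map_zero _⟩
  add_mem' := fun {a b} ha hb =>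
    ⟨fun j h1 h2 => by rw [map_add, ha.1 j h1 h2, hb.1 j h1 h2, add_zero],
      fun e he => by rw [map_add, ha.2 e he, hb.2 e he, add_zero]⟩
  smul_mem' := fun c {a} ha =>
    ⟨fun j h1 h2 => by rw [map_smul, ha.1 j h1 h2, smul_zero],
      fun e he => by rw [map_smul, ha.2 e he, smul_zero]⟩

/-- The point `x` lies in the relative interior of the face: it has no tight edge outside `S`, so it
can be moved inside the face along every vector of `faceDirection n S`. -/
lemma vectorSpan_face {S : Set ((ℕ × ℕ) × Bool)} {x : gcIndex n → ℝ} (hx : x ∈ face n lam S)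
    (h : ∀ e ∈ edges n, gap e x = 0 → e ∈ S) :
    vectorSpan ℝ (face n lam S) = faceDirection n S := by
  refine le_antisymm (Submodule.span_le.2 ?_) fun v hv => ?_
  · rintro _ ⟨a, ha, b, hb, rfl⟩
    refine ⟨fun j h1 h2 => ?_, fun e he => ?_⟩
    · simp only [vsub_eq_sub]
      rw [map_sub, ha.1.1 j h1 h2, hb.1.1 j h1 h2, sub_self]
    · simp only [vsub_eq_sub]
      rw [map_sub, ha.2 e he, hb.2 e he, sub_self]
  · obtain ⟨ε, hε, hm, -⟩ := exists_pos_mem_patterns hx.1 hv.1 fun e he h0 => hv.2 e (h e he h0)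
    have hm' : x + ε • v ∈ face n lam S :=
      ⟨hm, fun e he => by rw [map_add, map_smul, hx.2 e he, hv.2 e he]; simp⟩
    have := (vectorSpan ℝ (face n lam S)).smul_mem ε⁻¹ (vsub_mem_vectorSpan ℝ hm' hx)
    rwa [vsub_eq_sub, add_sub_cancel_left, smul_smul, inv_mul_cancel₀ hε.ne', one_smul] at this

/-- The direction is the kernel of `gap e` on the space of arrays with zero top row. This functional
is nonzero there, since the lower end of the edge is not in the top row. -/
lemma finrank_faceDirection_singleton {e : (ℕ × ℕ) × Bool} (he : e ∈ edges n) :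
    Module.finrank ℝ (faceDirection n {e}) + 1 = Module.finrank ℝ (faceDirection n ∅) := by
  classical
  obtain ⟨⟨i, j⟩, b⟩ := e
  obtain ⟨h1, h2, h3⟩ := mem_edges.1 he
  let f : Module.Dual ℝ (faceDirection n ∅) :=
    (gap ((i, j), b)).toLinearMap.comp (faceDirection n ∅).subtype
  have hf : f ≠ 0 := by
    let v : gcIndex n → ℝ := fun p => if p.1 = (i, j) then 1 else 0
    have hv : ∀ a c, 1 ≤ c → c ≤ a → a ≤ n → ent a c v = if (a, c) = (i, j) then 1 else 0 :=
      fun a c k1 k2 k3 => (apply_idx v k1 k2 k3).symm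
    have hmem : v ∈ faceDirection n ∅ := by
      refine ⟨fun c k1 k2 => ?_, fun e he => he.elim⟩
      rw [hv n c k1 k2 le_rfl, if_neg]
      simp only [Prod.mk.injEq]; omega
    intro h0
    have : gap ((i, j), b) v = 0 := LinearMap.congr_fun h0 ⟨v, hmem⟩
    cases b
    · rw [gap_false, hv i j h1 h2 (by omega), hv (i + 1) (j + 1) (by omega) (by omega) h3] at this
      simp at this
    · rw [gap_true, hv i j h1 h2 (by omega), hv (i + 1) j (by omega) (by omega) h3] at this
      simp at this
  have hker : faceDirection n {((i, j), b)} =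
      (LinearMap.ker f).map (faceDirection n ∅).subtype := by
    ext v
    simp only [Submodule.mem_map, LinearMap.mem_ker, Submodule.subtype_apply, Subtype.exists,
      exists_and_right, exists_eq_right]
    constructor
    · intro hv
      exact ⟨⟨hv.1, fun e he => he.elim⟩, hv.2 _ rfl⟩
    · rintro ⟨hv, hg⟩
      refine ⟨hv.1, ?_⟩
      rintro _ rfl
      exact hg
  rw [hker, Submodule.finrank_map_subtype_eq]
  exact Module.Dual.finrank_ker_add_one_of_ne_zero hf

/-- The array with top row `lam` whose row `n - k - 1` interpolates between the neighbours in row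
`n - k` with weights `t (n - k - 1)`. -/
def interpolate (n : ℕ) (lam : ℕ → ℕ) (t : ℕ → ℕ → ℝ) : ℕ → ℕ → ℝ
  | 0, j => lam j
  | k + 1, j => t (n - (k + 1)) j * interpolate n lam t k j +
      (1 - t (n - (k + 1)) j) * interpolate n lam t k (j + 1)

lemma exists_interpolation (n : ℕ) (lam : ℕ → ℕ) (t : ℕ → ℕ → ℝ) :
    ∃ x : gcIndex n → ℝ, (∀ j, 1 ≤ j → j ≤ n → ent n j x = lam j) ∧
      ∀ i j, 1 ≤ j → j ≤ i → i + 1 ≤ n →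
        ent i j x = t i j * ent (i + 1) j x + (1 - t i j) * ent (i + 1) (j + 1) x := by
  let x : gcIndex n → ℝ := fun p => interpolate n lam t (n - p.1.1) p.1.2
  have hx : ∀ i j, 1 ≤ j → j ≤ i → i ≤ n → ent i j x = interpolate n lam t (n - i) j :=
    fun i j h1 h2 h3 => (apply_idx x h1 h2 h3).symm
  refine ⟨x, fun j h1 h2 => ?_, fun i j h1 h2 h3 => ?_⟩
  · rw [hx n j h1 h2 le_rfl, Nat.sub_self]; rfl
  · rw [hx i j h1 h2 (by omega), hx (i + 1) j h1 (by omega) h3,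
      hx (i + 1) (j + 1) (by omega) (by omega) h3]
    obtain ⟨k, hk⟩ : ∃ k, n = i + 1 + k := ⟨n - (i + 1), by omega⟩
    rw [show n - i = k + 1 by omega, show n - (i + 1) = k by omega, interpolate,
      show n - (k + 1) = i by omega]

/-- Weights in [0, 1] make each entry a convex combination of its upper neighbours. Two neighbours
in a row can collapse only if the left one copies its right parent and the right one copies the same
entry, which `h01` excludes. With strict rows, the tight edges are then read off from the weights 0
and 1. -/
lemma exists_pattern_of_weights (hlam : ∀ j : ℕ, 1 ≤ j → j < n → lam (j + 1) < lam j)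
    (t : ℕ → ℕ → ℝ) (h0 : ∀ i j, 0 ≤ t i j) (h1 : ∀ i j, t i j ≤ 1)
    (h01 : ∀ i j, t i j = 0 → t i (j + 1) < 1) :
    ∃ x ∈ patterns n lam, ∀ i j, 1 ≤ j → j ≤ i → i + 1 ≤ n →
      (gap ((i, j), true) x = 0 ↔ t i j = 1) ∧ (gap ((i, j), false) x = 0 ↔ t i j = 0) := by
  obtain ⟨x, htop, hrec⟩ := exists_interpolation n lam t
  have hstrict : StrictRows x := by
    intro i j k1 k2 k3
    induction k3 using Nat.decreasingInduction generalizing j with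
    | self =>
      rw [htop _ (by omega) k2, htop _ k1 (by omega)]
      exact_mod_cast hlam j k1 (by omega)
    | of_succ i hi ih =>
      rw [hrec i j k1 (by omega) hi, hrec i (j + 1) (by omega) k2 hi]
      have a1 := ih j k1 (by omega)
      have a2 := ih (j + 1) (by omega) (by omega)
      have b1 := mul_nonneg (h0 i j) (sub_pos.2 a1).le
      have b2 := mul_nonneg (sub_nonneg.2 (h1 i (j + 1))) (sub_pos.2 a2).le
      rcases (h0 i j).eq_or_lt with h | h
      · have := mul_pos (sub_pos.2 (h01 i j h.symm)) (sub_pos.2 a2)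
        nlinarith
      · have := mul_pos h (sub_pos.2 a1)
        nlinarith
  have hgap : ∀ i j, 1 ≤ j → j ≤ i → i + 1 ≤ n →
      gap ((i, j), true) x = (1 - t i j) * (ent (i + 1) j x - ent (i + 1) (j + 1) x) ∧
      gap ((i, j), false) x = t i j * (ent (i + 1) j x - ent (i + 1) (j + 1) x) := by
    intro i j k1 k2 k3
    rw [gap_true, gap_false, hrec i j k1 k2 k3]
    constructor <;> ring
  refine ⟨x, ⟨htop, ?_⟩, fun i j k1 k2 k3 => ?_⟩
  · rintro ⟨⟨i, j⟩, b⟩ he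
    obtain ⟨k1, k2, k3⟩ := mem_edges.1 he
    have hpos := (sub_pos.2 (hstrict (i + 1) j k1 (by omega) k3)).le
    cases b
    · rw [(hgap i j k1 k2 k3).2]; exact mul_nonneg (h0 i j) hpos
    · rw [(hgap i j k1 k2 k3).1]; exact mul_nonneg (sub_nonneg.2 (h1 i j)) hpos
  · have hpos := (sub_pos.2 (hstrict (i + 1) j k1 (by omega) k3)).ne'
    rw [(hgap i j k1 k2 k3).1, (hgap i j k1 k2 k3).2]
    simp only [mul_eq_zero, hpos, or_false, and_true]
    rw [sub_eq_zero, eq_comm]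

lemma exists_strict_pattern (hlam : ∀ j : ℕ, 1 ≤ j → j < n → lam (j + 1) < lam j) :
    ∃ x ∈ patterns n lam, ∀ e ∈ edges n, gap e x ≠ 0 := by
  obtain ⟨x, hx, h⟩ := exists_pattern_of_weights hlam (fun _ _ => 1 / 2)
    (fun _ _ => by norm_num) (fun _ _ => by norm_num) (fun _ _ _ => by norm_num)
  refine ⟨x, hx, ?_⟩
  rintro ⟨⟨i, j⟩, b⟩ he
  obtain ⟨k1, k2, k3⟩ := mem_edges.1 he
  cases b
  · rw [Ne, (h i j k1 k2 k3).2]; norm_num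
  · rw [Ne, (h i j k1 k2 k3).1]; norm_num

lemma exists_pattern_tight_only (hlam : ∀ j : ℕ, 1 ≤ j → j < n → lam (j + 1) < lam j)
    {e : (ℕ × ℕ) × Bool} (he : e ∈ edges n) :
    ∃ x ∈ patterns n lam, gap e x = 0 ∧ ∀ e' ∈ edges n, gap e' x = 0 → e' = e := by
  obtain ⟨x, hx, h⟩ := exists_pattern_of_weights hlam
    -- All weights are 1/2 except at the lower end of `e`, where 1 copies the upper neighbour in the
    -- same column and 0 copies the other one.
    (fun i j => if (i, j) = e.1 then (if e.2 then 1 else 0) else 1 / 2)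
    (fun _ _ => by split_ifs <;> norm_num) (fun _ _ => by split_ifs <;> norm_num)
    (fun i j hij => by
      have h1 : (i, j) = e.1 := by
        by_contra hne
        rw [if_neg hne] at hij
        norm_num at hij
      rw [if_neg]
      · norm_num
      · rw [← h1]; simp)
  obtain ⟨⟨i, j⟩, b⟩ := e
  obtain ⟨k1, k2, k3⟩ := mem_edges.1 he
  refine ⟨x, hx, ?_, ?_⟩
  · cases b
    · rw [(h i j k1 k2 k3).2]; simp
    · rw [(h i j k1 k2 k3).1]; simp
  · rintro ⟨⟨i', j'⟩, b'⟩ he' h0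
    obtain ⟨k1', k2', k3'⟩ := mem_edges.1 he'
    by_cases hp : (i', j') = (i, j)
    · cases b' <;> cases b
      · rw [hp]
      · rw [(h i' j' k1' k2' k3').2, if_pos hp] at h0; simp at h0
      · rw [(h i' j' k1' k2' k3').1, if_pos hp] at h0; simp at h0
      · rw [hp]
    · cases b'
      · rw [(h i' j' k1' k2' k3').2, if_neg hp] at h0; norm_num at h0
      · rw [(h i' j' k1' k2' k3').1, if_neg hp] at h0; norm_num at h0

lemma face_empty : face n lam ∅ = patterns n lam := by simp [face]

lemma finrank_vectorSpan_face (hlam : ∀ j : ℕ, 1 ≤ j → j < n → lam (j + 1) < lam j)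
    {e : (ℕ × ℕ) × Bool} (he : e ∈ edges n) :
    Module.finrank ℝ (vectorSpan ℝ (face n lam {e})) + 1 =
      Module.finrank ℝ (vectorSpan ℝ (patterns n lam)) := by
  obtain ⟨x, hx, h0, h⟩ := exists_pattern_tight_only hlam he
  obtain ⟨y, hy, hy0⟩ := exists_strict_pattern hlam
  rw [vectorSpan_face (x := x) ⟨hx, by simpa using h0⟩ (by simpa using h), ← face_empty,
    vectorSpan_face (x := y) ⟨hy, by simp⟩ (fun e he h => absurd h (hy0 e he))]
  exact finrank_faceDirection_singleton he

lemma isFacet_face (hlam : ∀ j : ℕ, 1 ≤ j → j < n → lam (j + 1) < lam j)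
    {e : (ℕ × ℕ) × Bool} (he : e ∈ edges n) : IsFacet (patterns n lam) (face n lam {e}) := by
  obtain ⟨x, hx, h0, -⟩ := exists_pattern_tight_only hlam he
  -- The functional `-gap e` is at most 0 on the patterns and attains 0, so it exposes the face
  -- where `gap e` vanishes.
  refine ⟨fun _ => ⟨-gap e, ?_⟩, ⟨x, hx, by simpa using h0⟩, finrank_vectorSpan_face hlam he⟩
  ext y
  simp only [face, Set.mem_singleton_iff, forall_eq, Set.mem_ofPred_eq,
    neg_apply, neg_le_neg_iff]
  refine and_congr_right fun hy => ⟨fun h w hw => ?_, fun h => ?_⟩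
  · rw [h]; exact hw.2 e he
  · exact le_antisymm ((h x hx).trans_eq h0) (hy.2 e he)

lemma face_injOn (hlam : ∀ j : ℕ, 1 ≤ j → j < n → lam (j + 1) < lam j) :
    Set.InjOn (fun e => face n lam {e}) (edges n : Set ((ℕ × ℕ) × Bool)) := by
  intro e he e' he' heq
  obtain ⟨x, hx, h0, h⟩ := exists_pattern_tight_only hlam he
  have hmem : x ∈ face n lam {e} := ⟨hx, by simpa using h0⟩
  simp only at heq
  rw [heq] at hmem
  exact (h e' he' (hmem.2 e' rfl)).symm

/-- A convex set of patterns that lies in none of the faces of the edges contains a pattern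
without tight inequalities. -/
lemma exists_strict_mem {F : Set (gcIndex n → ℝ)} (hF : F ⊆ patterns n lam) (hc : Convex ℝ F)
    (hne : F.Nonempty) (S : Finset ((ℕ × ℕ) × Bool)) (hS : S ⊆ edges n)
    (h : ∀ e ∈ S, ∃ x ∈ F, gap e x ≠ 0) : ∃ x ∈ F, ∀ e ∈ S, gap e x ≠ 0 := by
  classical
  induction S using Finset.induction_on with
  | empty => exact ⟨hne.some, hne.some_mem, by simp⟩
  | insert e S _ ih =>
    obtain ⟨x, hx, hxS⟩ := ih (fun a ha => hS (Finset.mem_insert_of_mem ha))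
      fun a ha => h a (Finset.mem_insert_of_mem ha)
    obtain ⟨y, hy, hye⟩ := h e (Finset.mem_insert_self _ _)
    refine ⟨(1 / 2 : ℝ) • x + (1 / 2 : ℝ) • y,
      hc hx hy (by norm_num) (by norm_num) (by norm_num), fun a ha => ?_⟩
    have px := (hF hx).2 a (hS ha)
    have py := (hF hy).2 a (hS ha)
    rw [map_add, map_smul, map_smul, smul_eq_mul, smul_eq_mul]
    rcases Finset.mem_insert.1 ha with rfl | ha'
    · have := lt_of_le_of_ne py (Ne.symm hye)
      positivity
    · have := lt_of_le_of_ne px (Ne.symm (hxS a ha'))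
      positivity

/-- If the facet lies in no face of an edge, it contains a point without tight edges, and the
exposing functional is constant on the polytope, against the dimension. If it lies in the face of
`e`, equal dimensions give equal spans, so the functional is constant on that face and the face lies
in the facet. -/
lemma exists_eq_face_of_isFacet (hlam : ∀ j : ℕ, 1 ≤ j → j < n → lam (j + 1) < lam j)
    {F : Set (gcIndex n → ℝ)} (hF : IsFacet (patterns n lam) F) :
    ∃ e ∈ edges n, face n lam {e} = F := by
  obtain ⟨hexp, hne, hrank⟩ := hF
  obtain ⟨l, hl⟩ := hexp hne
  have hsub : F ⊆ patterns n lam := hexp.subset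
  by_cases hall : ∀ e ∈ edges n, ∃ x ∈ F, gap e x ≠ 0
  · exfalso
    obtain ⟨x, hx, hxs⟩ := exists_strict_mem hsub (hexp.convex convex_patterns) hne _
      subset_rfl hall
    have hFP : F = patterns n lam := by
      refine hsub.antisymm fun y hy => ?_
      -- The segment from `y` to `x` can be prolonged a little beyond `x`; maximality of `l` at `x`
      -- then gives `l x ≤ l y`.
      obtain ⟨ε, hε, -, hm⟩ := exists_pos_mem_patterns (v := y - x) (hsub hx)
        (fun j h1 h2 => by rw [map_sub, hy.1 j h1 h2, (hsub hx).1 j h1 h2, sub_self])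
        (fun e he h0 => absurd h0 (hxs e he))
      rw [hl] at hx ⊢
      refine ⟨hy, fun w hw => (hx.2 w hw).trans ?_⟩
      have := hx.2 _ hm
      rw [map_sub, map_smul, map_sub, smul_eq_mul] at this
      have h2 : 0 ≤ ε * (l y - l x) := by linarith
      linarith [nonneg_of_mul_nonneg_right h2 hε]
    rw [hFP] at hrank
    omega
  · push Not at hall
    obtain ⟨e, he, hFe⟩ := hall
    refine ⟨e, he, ?_⟩
    have hFe' : F ⊆ face n lam {e} := fun x hx => ⟨hsub hx, by simpa using hFe x hx⟩
    refine Set.Subset.antisymm (fun y hy => ?_) hFe'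
    have hspan : vectorSpan ℝ F = vectorSpan ℝ (face n lam {e}) := by
      refine Submodule.eq_of_le_of_finrank_eq (vectorSpan_mono ℝ hFe') ?_
      have := finrank_vectorSpan_face hlam he
      omega
    obtain ⟨x, hx⟩ := hne
    have hyx : y -ᵥ x ∈ vectorSpan ℝ F := by
      rw [hspan]; exact vsub_mem_vectorSpan ℝ hy (hFe' hx)
    have hker : vectorSpan ℝ F ≤ LinearMap.ker l.toLinearMap := by
      refine Submodule.span_le.2 ?_
      rintro _ ⟨a, ha, b, hb, rfl⟩
      rw [hl] at ha hb
      simp only [vsub_eq_sub]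
      rw [SetLike.mem_coe, LinearMap.mem_ker, map_sub, sub_eq_zero]
      exact le_antisymm (hb.2 a ha.1) (ha.2 b hb.1)
    have hlyx : l y = l x := by
      have := hker hyx
      rwa [LinearMap.mem_ker, vsub_eq_sub, map_sub, sub_eq_zero] at this
    rw [hl] at hx ⊢
    exact ⟨hy.1, fun w hw => (hx.2 w hw).trans_eq hlyx.symm⟩

lemma setOf_isFacet_eq (hlam : ∀ j : ℕ, 1 ≤ j → j < n → lam (j + 1) < lam j)
    {z : gcIndex n → ℝ} (hz : z ∈ patterns n lam) :
    {F | IsFacet (patterns n lam) F ∧ z ∈ F} =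
      (fun e => face n lam {e}) '' ((edges n).filter fun e => gap e z = 0 : Finset _) := by
  ext F
  simp only [Set.mem_ofPred_eq, Set.mem_image, Finset.coe_filter]
  constructor
  · rintro ⟨hF, hzF⟩
    obtain ⟨e, he, rfl⟩ := exists_eq_face_of_isFacet hlam hF
    exact ⟨e, ⟨he, hzF.2 e rfl⟩, rfl⟩
  · rintro ⟨e, ⟨he, h0⟩, rfl⟩
    exact ⟨isFacet_face hlam he, hz, by simpa using h0⟩

/-! ### Counting the facets through a vertex. -/

lemma card_gcIndex (m : ℕ) : (gcIndex m).card * 2 = (m + 1) * m := by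
  have h : (gcIndex m).card = ∑ i ∈ Finset.range (m + 1), i := by
    rw [Finset.card_eq_sum_card_fiberwise (f := Prod.fst) (t := Finset.range (m + 1))]
    · refine Finset.sum_congr rfl fun i hi => ?_
      have hi := Finset.mem_range.1 hi
      have : (gcIndex m).filter (fun p => p.1 = i) = (Finset.Icc 1 i).image (Prod.mk i) := by
        ext ⟨a, b⟩
        rw [Finset.mem_filter, mem_gcIndex, Finset.mem_image]
        simp only [Finset.mem_Icc, Prod.mk.injEq]
        constructor
        · rintro ⟨h1, rfl⟩
          exact ⟨b, by omega, rfl, rfl⟩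
        · rintro ⟨c, hc, rfl, rfl⟩
          omega
      rw [this, Finset.card_image_of_injective _ (Prod.mk_right_injective i), Nat.card_Icc]
      omega
    · rintro ⟨a, b⟩ hab
      have := mem_gcIndex.1 (Finset.mem_coe.1 hab)
      simp only [Finset.coe_range, Set.mem_Iio]
      omega
  rw [h, Finset.sum_range_id_mul_two]
  rfl

/-- Each position below the top row contributes at least one tight edge, so the total is minimal
exactly when each contributes one. Both edges are tight precisely when the two upper neighbours are
equal. -/
lemma card_tight_eq_iff {z : gcIndex n → ℝ} (hz : z ∈ (patterns n lam).extremePoints ℝ) :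
    ((edges n).filter fun e => gap e z = 0).card = n * (n - 1) / 2 ↔ StrictRows z := by
  have hcard : n * (n - 1) / 2 = ∑ p ∈ gcIndex (n - 1), 1 := by
    rw [Finset.sum_const, smul_eq_mul, mul_one]
    have := card_gcIndex (n - 1)
    rcases n with _ | n
    · rfl
    · rw [Nat.add_sub_cancel] at this ⊢
      omega
  have hsum : ((edges n).filter fun e => gap e z = 0).card = ∑ p ∈ gcIndex (n - 1),
      ((if gap (p, true) z = 0 then 1 else 0) + if gap (p, false) z = 0 then 1 else 0) := by
    rw [Finset.card_filter, edges, Finset.sum_product]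
    refine Finset.sum_congr rfl fun p _ => ?_
    rw [Fintype.sum_bool]
  rw [hsum, hcard, eq_comm, Finset.sum_eq_sum_iff_of_le]
  · constructor
    · intro h i j h1 h2 h3
      refine lt_of_le_of_ne (ent_anti hz.1 h1 (by omega) h2 h3) fun heq => ?_
      obtain ⟨i, rfl⟩ : ∃ i', i = i' + 1 := ⟨i - 1, by omega⟩
      have a1 := ent_le_left hz.1 h1 (by omega : j ≤ i) h3
      have a2 := right_le_ent hz.1 h1 (by omega : j ≤ i) h3
      have := h (i, j) (mem_gcIndex.2 ⟨h1, by omega, by omega⟩)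
      rw [gap_true, gap_false, if_pos (by linarith), if_pos (by linarith)] at this
      omega
    · rintro h ⟨i, j⟩ hp
      obtain ⟨h1, h2, h3⟩ := mem_gcIndex.1 hp
      have hs := h (i + 1) j h1 (by omega) (by omega)
      rw [gap_true, gap_false]
      rcases ent_eq_or_eq hz h1 h2 (by omega) with h | h
      · rw [if_pos (by linarith), if_neg (by linarith)]
      · rw [if_neg (by linarith), if_pos (by linarith)]
  · rintro ⟨i, j⟩ hp
    obtain ⟨h1, h2, h3⟩ := mem_gcIndex.1 hp
    rw [gap_true, gap_false]
    rcases ent_eq_or_eq hz h1 h2 (by omega) with h | h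
    · rw [if_pos (by linarith)]; omega
    · rw [if_pos (sub_eq_zero.2 h)]; omega

theorem mem_regularVertices_iff (hlam : ∀ j : ℕ, 1 ≤ j → j < n → lam (j + 1) < lam j)
    {z : gcIndex n → ℝ} : z ∈ regularVertices n lam ↔ z ∈ vertices n lam ∧ StrictRows z := by
  refine and_congr_right fun hz => ?_
  rw [vertices_eq hlam] at hz
  rw [polytope_eq_patterns hlam, setOf_isFacet_eq hlam hz.1,
    Set.InjOn.encard_image ((face_injOn hlam).mono
      (Finset.coe_subset.2 (Finset.filter_subset _ _))), Set.encard_coe_eq_coe_finsetCard,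
    Nat.cast_inj, card_tight_eq_iff hz]

/-! ### Weights of monomials -/

lemma toReal_injective : Function.Injective (toReal (n := n)) := fun _ _ h =>
  funext fun p => Int.cast_injective (congrFun h p)

lemma le_orderEmbedding {r : ℕ} (I : Fin r ↪o Fin n) (a : Fin r) : a.1 ≤ (I a).1 := by
  obtain ⟨k, hk⟩ := a
  induction k with
  | zero => exact Nat.zero_le _
  | succ k ih =>
    have h1 := ih (by omega)
    have h2 : (I ⟨k, by omega⟩).1 < (I ⟨k + 1, hk⟩).1 :=
      I.strictMono (show (⟨k, by omega⟩ : Fin r) < ⟨k + 1, hk⟩ from Nat.lt_succ_self k)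
    simp only at h1 ⊢
    omega

/-- `phi` followed by the inclusion of the lattice, as an additive map. -/
def phiHom (n : ℕ) : (gcIndex n → ℤ) →+ (gcIndex n → ℝ) where
  toFun b := toReal (phi b)
  map_zero' := by funext p; simp [toReal, phi]
  map_add' a b := by
    funext p
    simp only [toReal, phi, Pi.add_apply]
    rw [← Int.cast_add, ← Finset.sum_add_distrib]
    congr 1
    refine Finset.sum_congr rfl fun q _ => ?_
    split_ifs <;> simp

/-- The weight of the coordinate `p_I`. -/
def weight {r : ℕ} (I : Fin r ↪o Fin n) : gcIndex n → ℝ := phiHom n (beta I)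

lemma phi_idx (b : gcIndex n → ℤ) {i j : ℕ} (h1 : 1 ≤ j) (h2 : j ≤ i) (h3 : i ≤ n) :
    phi b (idx i j h1 h2 h3) = ∑ q, if q.1.2 = j ∧ q.1.1 ≤ i then b q else 0 := rfl

lemma ent_weight {r : ℕ} (I : Fin r ↪o Fin n) {i j : ℕ} (h1 : 1 ≤ j) (h2 : j ≤ i) (h3 : i ≤ n) :
    ent i j (weight I) = if ∃ a : Fin r, a.1 + 1 = j ∧ (I a).1 + 1 ≤ i then 1 else 0 := by
  rw [← apply_idx _ h1 h2 h3]
  change ((phi (beta I) (idx i j h1 h2 h3) : ℤ) : ℝ) = _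
  simp only [phi_idx, beta]
  split_ifs with h
  · obtain ⟨a, ha, hai⟩ := h
    have hmem : ((I a).1 + 1, a.1 + 1) ∈ gcIndex n :=
      mem_gcIndex.2 ⟨by omega, by have := le_orderEmbedding I a; omega, by omega⟩
    rw [Finset.sum_eq_single ⟨_, hmem⟩]
    · rw [if_pos ⟨ha, hai⟩, if_pos ⟨a, rfl, rfl⟩]; simp
    · rintro ⟨⟨i', j'⟩, hq⟩ - hne
      rw [ite_eq_right_iff]
      rintro ⟨hj, -⟩
      rw [if_neg]
      rintro ⟨b, hb, hbi⟩
      simp only at hj hb hbi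
      obtain rfl : b = a := Fin.ext (by omega)
      exact hne (Subtype.ext (by simp [hb, hbi]))
    · exact fun h => absurd (Finset.mem_univ _) h
  · rw [Finset.sum_eq_zero, Int.cast_zero]
    rintro ⟨⟨i', j'⟩, hq⟩ -
    rw [ite_eq_right_iff]
    rintro ⟨hj, hi⟩
    rw [if_neg]
    rintro ⟨b, hb, hbi⟩
    simp only at hj hi hb hbi
    exact h ⟨b, by omega, by omega⟩

lemma ent_weight_succ {r : ℕ} (I : Fin r ↪o Fin n) (a : Fin r) {i : ℕ} (h2 : a.1 + 1 ≤ i)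
    (h3 : i ≤ n) : ent i (a.1 + 1) (weight I) = if (I a).1 + 1 ≤ i then 1 else 0 := by
  rw [ent_weight I (by omega) h2 h3]
  refine if_congr ⟨?_, fun h => ⟨a, rfl, h⟩⟩ rfl rfl
  rintro ⟨b, hb, h⟩
  obtain rfl : b = a := Fin.ext (by omega)
  exact h

lemma ent_weight_of_lt {r : ℕ} (I : Fin r ↪o Fin n) {i j : ℕ} (hr : r < j) (h2 : j ≤ i)
    (h3 : i ≤ n) : ent i j (weight I) = 0 := by
  rw [ent_weight I (by omega) h2 h3, if_neg]
  rintro ⟨b, hb, -⟩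
  omega

lemma ent_top_weight {r : ℕ} (I : Fin r ↪o Fin n) {j : ℕ} (h1 : 1 ≤ j) (h2 : j ≤ n) :
    ent n j (weight I) = if j ≤ r then 1 else 0 := by
  split_ifs with h
  · have := ent_weight_succ I ⟨j - 1, by omega⟩ (i := n) (by simp only; omega) le_rfl
    rw [if_pos (by omega)] at this
    simpa only [Nat.sub_add_cancel h1] using this
  · exact ent_weight_of_lt I (by omega) h2 le_rfl

lemma weight_injective {r : ℕ} : Function.Injective (weight (n := n) (r := r)) := by
  have key : ∀ I J : Fin r ↪o Fin n, weight I = weight J → ∀ a, (J a).1 ≤ (I a).1 := by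
    intro I J h a
    have ha := le_orderEmbedding I a
    have h1 := ent_weight_succ I a (i := (I a).1 + 1) (by omega) (by omega)
    rw [h, ent_weight_succ J a (by omega) (by omega), if_pos le_rfl] at h1
    by_contra hlt
    rw [if_neg (by omega)] at h1
    exact zero_ne_one h1
  intro I J h
  ext a
  exact le_antisymm (key J I h.symm a) (key I J h a)

lemma gap_weight_nonneg {r : ℕ} (I : Fin r ↪o Fin n) {e : (ℕ × ℕ) × Bool} (he : e ∈ edges n) :
    0 ≤ gap e (weight I) := by
  obtain ⟨⟨i, j⟩, b⟩ := e
  obtain ⟨h1, h2, h3⟩ := mem_edges.1 he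
  cases b
  · rw [gap_false, sub_nonneg]
    rw [ent_weight I h1 h2 (by omega), ent_weight I (by omega) (by omega) h3]
    split_ifs with ha hb <;> try norm_num
    obtain ⟨a, ha, hai⟩ := ha
    -- A sequence is strictly increasing: if its member number j + 1 is at most i + 1, its member
    -- number j is at most i.
    refine hb ⟨⟨a.1 - 1, by omega⟩, by simp only; omega, ?_⟩
    have : (I ⟨a.1 - 1, by omega⟩).1 < (I a).1 :=
      I.strictMono (show a.1 - 1 < a.1 by omega)
    omega
  · rw [gap_true, sub_nonneg]
    rw [ent_weight I h1 h2 (by omega), ent_weight I h1 (by omega) h3]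
    split_ifs with ha hb <;> try norm_num
    obtain ⟨a, ha, hai⟩ := ha
    exact hb ⟨a, ha, by omega⟩

/-- In each column the join and the meet only redistribute the two members as maximum and minimum,
so the defining binomials of X_0 are homogeneous for the weight. -/
lemma weight_join_add_weight_meet {l m : ℕ} (h : m ≤ l) (I : Fin l ↪o Fin n)
    (J : Fin m ↪o Fin n) : weight (join h I J) + weight (meet I J) = weight I + weight J := by
  refine ext_ent fun i j h1 h2 h3 => ?_
  obtain ⟨j, rfl⟩ : ∃ j', j = j' + 1 := ⟨j - 1, by omega⟩
  rw [map_add, map_add]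
  by_cases hm : j < m
  · have e1 := ent_weight_succ I ⟨j, by omega⟩ h2 h3
    have e2 := ent_weight_succ J ⟨j, hm⟩ h2 h3
    have e3 := ent_weight_succ (join h I J) ⟨j, hm⟩ h2 h3
    have e4 := ent_weight_succ (meet I J) ⟨j, by omega⟩ h2 h3
    have f3 : join h I J ⟨j, hm⟩ = max (I ⟨j, by omega⟩) (J ⟨j, hm⟩) := rfl
    have f4 : meet I J ⟨j, by omega⟩ = min (I ⟨j, by omega⟩) (J ⟨j, hm⟩) := dif_pos hm
    simp only at e1 e2 e3 e4
    rw [e1, e2, e3, e4, f3, f4]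
    rcases le_total (I ⟨j, by omega⟩) (J ⟨j, hm⟩) with hle | hle
    · rw [max_eq_right hle, min_eq_left hle, add_comm]
    · rw [max_eq_left hle, min_eq_right hle]
  · rw [ent_weight_of_lt J (by omega) h2 h3, ent_weight_of_lt (join h I J) (by omega) h2 h3,
      zero_add, add_zero]
    by_cases hl : j < l
    · have e1 := ent_weight_succ I ⟨j, hl⟩ h2 h3
      have e4 := ent_weight_succ (meet I J) ⟨j, hl⟩ h2 h3
      have f4 : meet I J ⟨j, hl⟩ = I ⟨j, hl⟩ := dif_neg hm
      simp only at e1 e4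
      rw [e1, e4, f4]
    · rw [ent_weight_of_lt I (by omega) h2 h3, ent_weight_of_lt (meet I J) (by omega) h2 h3]

lemma toReal_monomialWeight (s : MonomialIndex n lam) :
    toReal (monomialWeight s) = (∑ r, ∑ a, weight (s r a)) +
      bdiff n lam n • weight (RelEmbedding.refl _ : Fin n ↪o Fin n) := by
  change phiHom n _ = _
  rw [map_add, map_nsmul, map_sum]
  simp only [map_sum]
  rfl

/-- The sum of the b_r over r from c to n telescopes. -/
lemma sum_bdiff (hlam : ∀ j : ℕ, 1 ≤ j → j < n → lam (j + 1) < lam j) {c : ℕ} (h1 : 1 ≤ c)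
    (h2 : c ≤ n) :
    (∑ r : Set.Ioo 0 n, ∑ _a : Fin (bdiff n lam r.1), if c ≤ r.1 then (1 : ℝ) else 0) +
      bdiff n lam n = lam c := by
  have hs : ∀ m, c ≤ m → m ≤ n →
      ∑ r ∈ Finset.Ico c m, (bdiff n lam r : ℝ) = lam c - lam m := by
    intro m hm
    induction m, hm using Nat.le_induction with
    | base => simp
    | succ k hk ih =>
      intro hkn
      rw [Finset.sum_Ico_succ_top hk, ih (by omega), bdiff, if_pos (by omega),
        Nat.cast_sub (hlam k (by omega) (by omega)).le]
      ring
  have hsum : (∑ r : Set.Ioo 0 n, ∑ _a : Fin (bdiff n lam r.1), if c ≤ r.1 then (1 : ℝ) else 0) =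
      ∑ r ∈ Finset.Ico c n, (bdiff n lam r : ℝ) := by
    have : Finset.Ico c n = (Finset.Ioo 0 n).filter (fun r => c ≤ r) := by
      ext r; simp only [Finset.mem_Ico, Finset.mem_filter, Finset.mem_Ioo]; omega
    rw [this, Finset.sum_filter, Finset.sum_subtype (p := (· ∈ Set.Ioo 0 n)) (Finset.Ioo 0 n)
      (fun r => by simp)]
    refine Finset.sum_congr rfl fun r _ => ?_
    rw [Finset.sum_const, Finset.card_univ, Fintype.card_fin]
    split_ifs <;> simp
  rw [hsum, hs n h2 le_rfl, bdiff, if_neg (lt_irrefl n)]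
  ring

lemma monomialWeight_mem (hlam : ∀ j : ℕ, 1 ≤ j → j < n → lam (j + 1) < lam j)
    (s : MonomialIndex n lam) : toReal (monomialWeight s) ∈ patterns n lam := by
  rw [toReal_monomialWeight]
  refine ⟨fun j h1 h2 => ?_, fun e he => ?_⟩
  · rw [map_add, map_sum, map_nsmul, ent_top_weight _ h1 h2, if_pos h2, nsmul_one,
      ← sum_bdiff hlam h1 h2]
    congr 1
    refine Finset.sum_congr rfl fun r _ => ?_
    rw [map_sum]
    exact Finset.sum_congr rfl fun a _ => ent_top_weight _ h1 h2
  · rw [map_add, map_sum, map_nsmul]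
    refine add_nonneg (Finset.sum_nonneg fun r _ => ?_)
      (nsmul_nonneg (gap_weight_nonneg _ he) _)
    rw [map_sum]
    exact Finset.sum_nonneg fun a _ => gap_weight_nonneg _ he

/-! ### Exchange of one factor of a monomial -/

/-- The monomial `s` with its factor number `a` of degree `r` replaced by `K`. -/
def exchange (s : MonomialIndex n lam) (r : Set.Ioo 0 n) (a : Fin (bdiff n lam r.1))
    (K : Fin r.1 ↪o Fin n) : MonomialIndex n lam :=
  Function.update s r (Function.update (s r) a K)

/-- Stated without division and for any commutative monoid, so that it serves both the values of
monomials, where a factor may vanish, and their weights, written multiplicatively. -/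
lemma prod_exchange {M : Type*} [CommMonoid M] (f : ∀ r : Set.Ioo 0 n, (Fin r.1 ↪o Fin n) → M)
    (s : MonomialIndex n lam) (r : Set.Ioo 0 n) (a : Fin (bdiff n lam r.1))
    (K : Fin r.1 ↪o Fin n) :
    (∏ q, ∏ b, f q (exchange s r a K q b)) * f r (s r a) = (∏ q, ∏ b, f q (s q b)) * f r K := by
  have h1 : ∀ q ∈ Finset.univ.erase r, ∏ b, f q (exchange s r a K q b) = ∏ b, f q (s q b) := by
    intro q hq
    rw [exchange, Function.update_of_ne (Finset.ne_of_mem_erase hq)]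
  have h2 : ∀ b ∈ Finset.univ.erase a, f r (exchange s r a K r b) = f r (s r b) := by
    intro b hb
    rw [exchange, Function.update_self, Function.update_of_ne (Finset.ne_of_mem_erase hb)]
  have h3 : exchange s r a K r a = K := by rw [exchange, Function.update_self, Function.update_self]
  rw [← Finset.mul_prod_erase _ _ (Finset.mem_univ r),
    ← Finset.mul_prod_erase Finset.univ (fun q => ∏ b, f q (s q b)) (Finset.mem_univ r),
    ← Finset.mul_prod_erase _ _ (Finset.mem_univ a),
    ← Finset.mul_prod_erase Finset.univ (fun b => f r (s r b)) (Finset.mem_univ a),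
    Finset.prod_congr rfl h1, Finset.prod_congr rfl h2, h3]
  ac_rfl

lemma monomialWeight_exchange (s : MonomialIndex n lam) (r : Set.Ioo 0 n)
    (a : Fin (bdiff n lam r.1)) (K : Fin r.1 ↪o Fin n) :
    toReal (monomialWeight (exchange s r a K)) =
      toReal (monomialWeight s) + (weight K - weight (s r a)) := by
  have h := prod_exchange (M := Multiplicative (gcIndex n → ℝ))
    (fun q I => Multiplicative.ofAdd (weight I)) s r a K
  have h' : (∑ q, ∑ b, weight (exchange s r a K q b)) + weight (s r a) =
      (∑ q, ∑ b, weight (s q b)) + weight K := h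
  rw [toReal_monomialWeight, toReal_monomialWeight, eq_sub_of_add_eq h']
  abel

lemma monomialValue_exchange (s : MonomialIndex n lam) (r : Set.Ioo 0 n)
    (a : Fin (bdiff n lam r.1)) (K : Fin r.1 ↪o Fin n) (x : PluckerSpace n) :
    monomialValue (exchange s r a K) x * (x r).rep (s r a) = monomialValue s x * (x r).rep K :=
  prod_exchange (fun q I => (x q).rep I) s r a K

/-- Two monomials whose weight is the same vertex have the same factors. -/
lemma factor_eq_of_weight_eq_vertex (hlam : ∀ j : ℕ, 1 ≤ j → j < n → lam (j + 1) < lam j)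
    {z : gcIndex n → ℝ} (hz : z ∈ (patterns n lam).extremePoints ℝ) {s t : MonomialIndex n lam}
    (hs : toReal (monomialWeight s) = z) (ht : toReal (monomialWeight t) = z) (r : Set.Ioo 0 n)
    (a b : Fin (bdiff n lam r.1)) : s r a = t r b := by
  -- Swapping the two factors between `s` and `t` moves the weights from `z` to `z + v` and `z - v`,
  -- where `v` is the difference of the weights of the factors.
  have h1 := monomialWeight_mem hlam (exchange s r a (t r b))
  have h2 := monomialWeight_mem hlam (exchange t r b (s r a))
  rw [monomialWeight_exchange, hs] at h1
  rw [monomialWeight_exchange, ht, ← neg_sub, ← sub_eq_add_neg] at h2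
  exact (weight_injective (sub_eq_zero.1 (eq_zero_of_add_sub_mem hz h1 h2))).symm

/-! ### The sequences of a vertex -/

/-- The first row in which the entry of column `j` is at least `t`. -/
def firstRow (x : gcIndex n → ℝ) (t : ℝ) (j : ℕ) : ℕ := sInf {i | j ≤ i ∧ t ≤ ent i j x}

section FirstRow

variable {x : gcIndex n → ℝ} (hx : x ∈ patterns n lam) {t : ℝ}
include hx

/-- The top row satisfies the condition, so the infimum is attained and is not the default value 0.
-/
lemma firstRow_mem {j : ℕ} (h1 : 1 ≤ j) (h2 : j ≤ n) (ht : t ≤ lam j) :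
    j ≤ firstRow x t j ∧ t ≤ ent (firstRow x t j) j x :=
  Nat.sInf_mem (s := {i | j ≤ i ∧ t ≤ ent i j x}) ⟨n, h2, by rwa [hx.1 j h1 h2]⟩

lemma firstRow_le_iff {i j : ℕ} (h1 : 1 ≤ j) (h2 : j ≤ i) (h3 : i ≤ n) (ht : t ≤ lam j) :
    firstRow x t j ≤ i ↔ t ≤ ent i j x := by
  obtain ⟨ha, hb⟩ := firstRow_mem hx h1 (h2.trans h3) ht
  exact ⟨fun h => hb.trans (ent_mono hx h1 ha h h3), fun h => Nat.sInf_le ⟨h2, h⟩⟩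

lemma firstRow_le {j : ℕ} (h1 : 1 ≤ j) (h2 : j ≤ n) (ht : t ≤ lam j) : firstRow x t j ≤ n := by
  rw [firstRow_le_iff hx h1 h2 le_rfl ht, hx.1 j h1 h2]
  exact ht

lemma firstRow_lt_succ {j : ℕ} (h1 : 1 ≤ j) (h2 : j + 1 ≤ n) (ht : t ≤ lam j)
    (ht' : t ≤ lam (j + 1)) : firstRow x t j < firstRow x t (j + 1) := by
  obtain ⟨ha, hb⟩ := firstRow_mem hx (by omega) h2 ht'
  have hc := firstRow_le hx (by omega) h2 ht'
  obtain ⟨i, hi⟩ : ∃ i, firstRow x t (j + 1) = i + 1 := ⟨firstRow x t (j + 1) - 1, by omega⟩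
  rw [hi] at ha hb hc ⊢
  exact Nat.lt_succ_of_le ((firstRow_le_iff hx h1 (by omega) (by omega) ht).2
    (hb.trans (right_le_ent hx h1 (by omega) hc)))

end FirstRow

lemma cast_lam_le (hlam : ∀ j : ℕ, 1 ≤ j → j < n → lam (j + 1) < lam j) {j r : ℕ} (h1 : 1 ≤ j)
    (h : j ≤ r) (hr : r ≤ n) : (lam r : ℝ) ≤ lam j :=
  Nat.cast_le.2 (lam_le hlam h1 h hr)

lemma firstRow_lt (hlam : ∀ j : ℕ, 1 ≤ j → j < n → lam (j + 1) < lam j) {x : gcIndex n → ℝ}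
    (hx : x ∈ patterns n lam) {r j k : ℕ} (h1 : 1 ≤ j) (h : j < k) (hk : k ≤ r) (hr : r ≤ n) :
    firstRow x (lam r) j < firstRow x (lam r) k := by
  have hsucc : ∀ j, 1 ≤ j → j + 1 ≤ r → firstRow x (lam r) j < firstRow x (lam r) (j + 1) :=
    fun j h1 h2 => firstRow_lt_succ hx h1 (by omega)
      (cast_lam_le hlam h1 (by omega) hr) (cast_lam_le hlam (by omega) h2 hr)
  induction k, h using Nat.le_induction with
  | base => exact hsucc j h1 hk
  | succ k hk' ih => exact (ih (by omega)).trans (hsucc k (by omega) hk)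

/-- The sequence of length `r` that belongs to a pattern: its `j`-th member is the first row in
which the entry of column `j` is at least `lam r`. -/
def patternSeq (hlam : ∀ j : ℕ, 1 ≤ j → j < n → lam (j + 1) < lam j) {x : gcIndex n → ℝ}
    (hx : x ∈ patterns n lam) (r : ℕ) (hr : r ≤ n) : Fin r ↪o Fin n :=
  OrderEmbedding.ofStrictMono
    (fun a => ⟨firstRow x (lam r) (a.1 + 1) - 1, by
      have h := cast_lam_le hlam (show 1 ≤ a.1 + 1 by omega) a.2 hr
      have h1 := firstRow_mem hx (by omega) (by omega) h
      have h2 := firstRow_le hx (by omega) (by omega) h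
      omega⟩) (by
    intro a b hab
    have h := firstRow_lt hlam hx (show 1 ≤ a.1 + 1 by omega)
      (show a.1 + 1 < b.1 + 1 from Nat.succ_lt_succ hab) b.2 hr
    have h1 := firstRow_mem hx (t := lam r) (j := a.1 + 1) (by omega) (by omega)
      (cast_lam_le hlam (by omega) a.2 hr)
    change _ - 1 < _ - 1
    omega)

section PatternSeq

variable (hlam : ∀ j : ℕ, 1 ≤ j → j < n → lam (j + 1) < lam j) {z : gcIndex n → ℝ}

lemma patternSeq_succ (hz : z ∈ patterns n lam) {r : ℕ} (hr : r ≤ n) (a : Fin r) :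
    (patternSeq hlam hz r hr a).1 + 1 = firstRow z (lam r) (a.1 + 1) := by
  have h := (firstRow_mem hz (by omega) (by omega)
    (cast_lam_le hlam (show 1 ≤ a.1 + 1 by omega) a.2 hr)).1
  change firstRow z (lam r) (a.1 + 1) - 1 + 1 = _
  omega

lemma pathLE_patternSeq (hz : z ∈ patterns n lam) {l m : ℕ} (h : m ≤ l) (hl : l ≤ n) :
    PathLE (patternSeq hlam hz l hl) (patternSeq hlam hz m (h.trans hl)) := by
  refine ⟨h, fun a => ?_⟩
  have h1 := patternSeq_succ hlam hz hl (Fin.castLE h a)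
  have h2 := patternSeq_succ hlam hz (h.trans hl) a
  have hm := cast_lam_le hlam (show 1 ≤ a.1 + 1 by omega) a.2 (h.trans hl)
  obtain ⟨h3, h4⟩ := firstRow_mem hz (by omega) (by omega) hm
  have h5 := (firstRow_le_iff hz (by omega) h3 (firstRow_le hz (by omega) (by omega) hm)
    (cast_lam_le hlam (show 1 ≤ a.1 + 1 by omega) (by omega) hl)).2
    ((cast_lam_le hlam (by omega) h hl).trans h4)
  change (patternSeq hlam hz l hl (Fin.castLE h a)).1 ≤ (patternSeq hlam hz m _ a).1
  simp only [Fin.val_castLE] at h1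
  omega

/-- The weight of the sequence of level `lam r` is, at this position, the indicator of `lam r ≤ ent
i j z`, that is, of `c ≤ r`. Summed with multiplicities b_r this returns `lam c`. -/
lemma ent_weight_patternSeq (hz : z ∈ patterns n lam) {r c i j : ℕ} (hr : r ≤ n) (h1 : 1 ≤ j)
    (h2 : j ≤ i) (h3 : i ≤ n) (hjc : j ≤ c) (hcn : c ≤ n) (hr1 : 1 ≤ r)
    (hc : ent i j z = lam c) :
    ent i j (weight (patternSeq hlam hz r hr)) = if c ≤ r then 1 else 0 := by
  by_cases hjr : j ≤ r
  · obtain ⟨j, rfl⟩ : ∃ j', j = j' + 1 := ⟨j - 1, by omega⟩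
    have h := ent_weight_succ (patternSeq hlam hz r hr) ⟨j, hjr⟩ h2 h3
    rw [patternSeq_succ] at h
    simp only at h
    rw [h]
    refine if_congr ?_ rfl rfl
    rw [firstRow_le_iff hz h1 h2 h3 (cast_lam_le hlam h1 hjr hr), hc, Nat.cast_le]
    refine ⟨fun hle => ?_, fun hcr => lam_le hlam (by omega) hcr hr⟩
    by_contra hlt
    exact absurd (lam_lt hlam hr1 (not_le.1 hlt) hcn) (not_lt.2 hle)
  · rw [ent_weight_of_lt _ (by omega) h2 h3, if_neg (by omega)]

/-- The monomial of the sequences of a pattern. -/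
def patternMonomial (hz : z ∈ patterns n lam) : MonomialIndex n lam :=
  fun r _ => patternSeq hlam hz r.1 r.2.2.le

lemma monomialWeight_patternMonomial (hz : z ∈ (patterns n lam).extremePoints ℝ) :
    toReal (monomialWeight (patternMonomial hlam hz.1)) = z := by
  rw [toReal_monomialWeight]
  refine ext_ent fun i j h1 h2 h3 => ?_
  obtain ⟨c, hjc, hcn, hc⟩ := exists_ent_eq_lam hz h1 h2 h3
  have hrefl : ent i j (weight (RelEmbedding.refl _ : Fin n ↪o Fin n)) = 1 := by
    rw [ent_weight _ h1 h2 h3, if_pos]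
    exact ⟨⟨j - 1, by omega⟩, by simp only; omega, by
      change j - 1 + 1 ≤ i
      omega⟩
  rw [map_add, map_sum, map_nsmul, hrefl, nsmul_one, hc,
    ← sum_bdiff hlam (show 1 ≤ c by omega) hcn]
  congr 1
  refine Finset.sum_congr rfl fun r _ => ?_
  rw [map_sum]
  exact Finset.sum_congr rfl fun a _ =>
    ent_weight_patternSeq hlam hz.1 r.2.2.le h1 h2 h3 hjc hcn r.2.1 hc

end PatternSeq

/-! ### Coordinate points of projective spaces -/

open Classical in
/-- The point with exactly one nonzero homogeneous coordinate. -/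
def coordinatePoint {ι : Type} (i : ι) : Projectivization ℂ (ι → ℂ) :=
  Projectivization.mk ℂ (Pi.single i 1) (by simp)

open Classical in
lemma coordinatePoint_rep {ι : Type} (i : ι) :
    ∃ u : ℂ, u ≠ 0 ∧ (coordinatePoint i).rep = u • (Pi.single i 1 : ι → ℂ) := by
  obtain ⟨u, hu⟩ := Projectivization.exists_smul_eq_mk_rep ℂ (Pi.single i 1 : ι → ℂ) (by simp)
  exact ⟨u, u.ne_zero, hu.symm⟩

lemma coordinatePoint_rep_self {ι : Type} (i : ι) : (coordinatePoint i).rep i ≠ 0 := by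
  obtain ⟨u, hu, h⟩ := coordinatePoint_rep i
  rw [h]; simpa using hu

lemma coordinatePoint_rep_of_ne {ι : Type} {i j : ι} (hij : j ≠ i) :
    (coordinatePoint i).rep j = 0 := by
  obtain ⟨u, hu, h⟩ := coordinatePoint_rep i
  rw [h]; simp [hij]

lemma mk_eq_coordinatePoint_iff {ι : Type} {i : ι} {w : ι → ℂ} (hw : w ≠ 0) :
    Projectivization.mk ℂ w hw = coordinatePoint i ↔ ∀ j, j ≠ i → w j = 0 := by
  classical
  rw [coordinatePoint, Projectivization.mk_eq_mk_iff']
  constructor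
  · rintro ⟨a, rfl⟩ j hj
    simp [hj]
  · refine fun h => ⟨w i, funext fun j => ?_⟩
    by_cases hj : j = i
    · subst hj; simp
    · simp [hj, h j hj]

lemma eq_coordinatePoint {ι : Type} {i : ι} {y : Projectivization ℂ (ι → ℂ)}
    (h : ∀ j, j ≠ i → y.rep j = 0) : y = coordinatePoint i := by
  rw [← y.mk_rep]
  exact (mk_eq_coordinatePoint_iff y.rep_nonzero).2 h

lemma eval_smul_of_isHomogeneous {ι : Type} {f : MvPolynomial ι ℂ} {d : ℕ}
    (hf : f.IsHomogeneous d) (u : ℂ) (x : ι → ℂ) :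
    MvPolynomial.eval (u • x) f = u ^ d * MvPolynomial.eval x f := by
  rw [MvPolynomial.eval_eq, MvPolynomial.eval_eq, Finset.mul_sum]
  refine Finset.sum_congr rfl fun m hm => ?_
  have hd : ∑ i ∈ m.support, m i = d := by
    simpa [Finsupp.weight_apply, Finsupp.sum] using hf (MvPolynomial.mem_support_iff.1 hm)
  simp only [Pi.smul_apply, smul_eq_mul, mul_pow, Finset.prod_mul_distrib]
  rw [Finset.prod_pow_eq_pow_sum, hd]
  ring

lemma toricSubvariety_singleton (m : LatticePoint n lam) :
    toricSubvariety n lam {toReal m.1} = {coordinatePoint m} := by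
  classical
  ext y
  rw [Set.mem_singleton_iff]
  constructor
  · intro hy
    refine eq_coordinatePoint fun k hk => ?_
    have h := hy (MvPolynomial.X k) 1 (MvPolynomial.isHomogeneous_X _ _) ?_
    · simpa using h
    · rintro _ ⟨t, rfl⟩
      rw [MvPolynomial.eval_X]
      simp only [Set.mem_singleton_iff]
      rw [if_neg fun h => hk (Subtype.ext (toReal_injective h))]
  · rintro rfl f d hf hA
    obtain ⟨u, -, hu⟩ := coordinatePoint_rep m
    rw [hu, eval_smul_of_isHomogeneous hf]
    -- The unit element of the torus realizes the coordinate vector itself as a point of the orbit.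
    refine mul_eq_zero_of_right _ (hA _ ⟨fun _ => 1, funext fun k => by
      by_cases hk : k = m
      · subst hk; simp [character]
      · have hne : toReal k.1 ≠ toReal m.1 := fun h => hk (Subtype.ext (toReal_injective h))
        simp [hk, hne]⟩)

/-! ### The point of a vertex -/

section VertexPoint

variable (hlam : ∀ j : ℕ, 1 ≤ j → j < n → lam (j + 1) < lam j) {z : gcIndex n → ℝ}

/-- The point all of whose Plücker coordinates vanish, except those of the sequences of `z`. -/
def vertexPoint (hz : z ∈ patterns n lam) : PluckerSpace n :=
  fun r => coordinatePoint (patternSeq hlam hz r.1 r.2.2.le)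

include hlam in
lemma bdiff_pos (r : Set.Ioo 0 n) : 0 < bdiff n lam r.1 := by
  rw [bdiff, if_pos r.2.2]
  exact Nat.sub_pos_of_lt (hlam _ r.2.1 r.2.2)

lemma eq_patternSeq_of_rep_ne_zero {hz : z ∈ patterns n lam} {r : Set.Ioo 0 n}
    {I : Fin r.1 ↪o Fin n} (h : (vertexPoint hlam hz r).rep I ≠ 0) :
    I = patternSeq hlam hz r.1 r.2.2.le := by
  by_contra hne
  exact h (coordinatePoint_rep_of_ne hne)

/-- For an incomparable pair both sides vanish. The left one does because the sequences of `z` are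
comparable. Were the right one nonzero, the join and meet would be the sequences of `z`; replacing
them by `I` and by `J` would move the weight by opposite vectors, and extremality would make `I` and
`J` the sequences of `z`. -/
lemma vertexPoint_mem_X0 (hz : z ∈ (patterns n lam).extremePoints ℝ) :
    vertexPoint hlam hz.1 ∈ X0 n := by
  intro l m h I J hIJ hJI
  have hcmp := pathLE_patternSeq hlam hz.1 h l.2.2.le
  have hleft : (vertexPoint hlam hz.1 l).rep I * (vertexPoint hlam hz.1 m).rep J = 0 := by
    by_contra hne
    rw [eq_patternSeq_of_rep_ne_zero hlam (left_ne_zero_of_mul hne),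
      eq_patternSeq_of_rep_ne_zero hlam (right_ne_zero_of_mul hne)] at hIJ
    exact hIJ hcmp
  rw [hleft]
  by_contra hne
  have hjoin := eq_patternSeq_of_rep_ne_zero hlam (left_ne_zero_of_mul (Ne.symm hne))
  have hmeet := eq_patternSeq_of_rep_ne_zero hlam (right_ne_zero_of_mul (Ne.symm hne))
  have hw := weight_join_add_weight_meet h I J
  rw [hjoin, hmeet] at hw
  have hs := monomialWeight_patternMonomial hlam hz
  have h1 := monomialWeight_mem hlam
    (exchange (patternMonomial hlam hz.1) l ⟨0, bdiff_pos hlam l⟩ I)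
  have h2 := monomialWeight_mem hlam
    (exchange (patternMonomial hlam hz.1) m ⟨0, bdiff_pos hlam m⟩ J)
  rw [monomialWeight_exchange, hs] at h1 h2
  simp only [patternMonomial] at h1 h2
  have hv : weight J - weight (patternSeq hlam hz.1 m.1 m.2.2.le) =
      -(weight I - weight (patternSeq hlam hz.1 l.1 l.2.2.le)) := by
    rw [neg_sub, sub_eq_sub_iff_add_eq_add, add_comm, ← hw, add_comm]
  rw [hv, ← sub_eq_add_neg] at h2
  have h0 := eq_zero_of_add_sub_mem hz h1 h2
  rw [h0, neg_zero] at hv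
  rw [weight_injective (sub_eq_zero.1 h0), weight_injective (sub_eq_zero.1 hv)] at hIJ
  exact hIJ hcmp

theorem X0Face_vertex (hz : z ∈ (patterns n lam).extremePoints ℝ) :
    X0Face n lam {z} = {vertexPoint hlam hz.1} := by
  have hP := polytope_eq_patterns hlam
  have hs := monomialWeight_patternMonomial hlam hz
  set s := patternMonomial hlam hz.1 with hsdef
  have hzP : toReal (monomialWeight s) ∈ polytope n lam := by rw [hP, hs]; exact hz.1
  let m : LatticePoint n lam := ⟨monomialWeight s, hzP⟩
  have htor : toricSubvariety n lam {z} = {coordinatePoint m} := by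
    rw [← toricSubvariety_singleton m, ← hs]
  ext x
  simp only [X0Face, htor, Set.mem_singleton_iff, exists_eq_left]
  constructor
  · rintro ⟨-, c, hc, hval⟩
    have hs0 : monomialValue s x ≠ 0 := by
      rw [hval s m rfl]
      exact mul_ne_zero hc (coordinatePoint_rep_self m)
    funext r
    refine eq_coordinatePoint fun K hK => ?_
    -- Strict decrease of `lam` gives a factor of every degree. Exchanging it for `K` changes the
    -- weight, so the new monomial vanishes at `x`, while `s` does not; hence the coordinate of `K`
    -- is zero.
    let a : Fin (bdiff n lam r.1) := ⟨0, bdiff_pos hlam r⟩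
    have hmem := monomialWeight_mem hlam (exchange s r a K)
    rw [← hP] at hmem
    have h := monomialValue_exchange s r a K x
    rw [hval (exchange s r a K) ⟨_, hmem⟩ rfl, coordinatePoint_rep_of_ne, mul_zero, zero_mul] at h
    · exact (mul_eq_zero.1 h.symm).resolve_left hs0
    · intro heq
      have hw : toReal (monomialWeight (exchange s r a K)) = toReal (monomialWeight s) :=
        congrArg (fun k : LatticePoint n lam => toReal k.1) heq
      rw [monomialWeight_exchange] at hw
      exact hK (weight_injective (sub_eq_zero.1 (add_eq_left.1 hw)))
  · rintro rfl
    refine ⟨vertexPoint_mem_X0 hlam hz, ?_⟩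
    have hm0 := coordinatePoint_rep_self m
    have hs0 : monomialValue s (vertexPoint hlam hz.1) ≠ 0 :=
      Finset.prod_ne_zero_iff.2 fun r _ => Finset.prod_ne_zero_iff.2 fun a _ =>
        coordinatePoint_rep_self _
    -- The scalar is forced by the coordinate at `m`. The only monomial of weight `z`, and also the
    -- only one nonzero at this point, is `s`.
    refine ⟨monomialValue s (vertexPoint hlam hz.1) / (coordinatePoint m).rep m,
      div_ne_zero hs0 hm0, fun t k htk => ?_⟩
    by_cases hk : k = m
    · subst hk
      have ht : t = s := funext fun r => funext fun a =>
        factor_eq_of_weight_eq_vertex hlam hz ((congrArg toReal htk).trans hs) hs r a a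
      rw [ht, div_mul_cancel₀ _ hm0]
    · rw [coordinatePoint_rep_of_ne hk, mul_zero]
      by_contra hne
      have ht : t = s := funext fun r => funext fun a =>
        eq_patternSeq_of_rep_ne_zero hlam (Finset.prod_ne_zero_iff.1
          (Finset.prod_ne_zero_iff.1 hne r (Finset.mem_univ _)) a (Finset.mem_univ _))
      exact hk (Subtype.ext (by rw [← htk, ht]))

end VertexPoint

/-! ### Coordinate points on the flag variety -/

/-- Sorting the columns changes the minor by a sign and turns it into a Plücker coordinate of a
sequence other than `I`. -/
lemma minor_eq_zero {r : ℕ} {v : Fin r → Fin n → ℂ} {I : Fin r ↪o Fin n}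
    (hv : ∀ K, K ≠ I → pluckerVector v K = 0) {f : Fin r → Fin n} (hf : Function.Injective f)
    {b : Fin r} (hb : f b ∉ Set.range I) : Matrix.det (Matrix.of fun a c => v a (f c)) = 0 := by
  let J : Fin r ↪o Fin n := OrderEmbedding.ofStrictMono (f ∘ Tuple.sort f)
    ((Tuple.monotone_sort f).strictMono_of_injective (hf.comp (Tuple.sort f).injective))
  have hJ : J ≠ I := by
    rintro h
    refine hb ⟨(Tuple.sort f).symm b, ?_⟩
    rw [← h]
    change f (Tuple.sort f ((Tuple.sort f).symm b)) = f b
    rw [Equiv.apply_symm_apply]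
  have h := Matrix.det_permute' (Tuple.sort f) (Matrix.of fun a c => v a (f c))
  have h' : pluckerVector v J = 0 := hv J hJ
  change Matrix.det ((Matrix.of fun a c => v a (f c)).submatrix id (Tuple.sort f)) = 0 at h'
  rw [h'] at h
  refine (mul_eq_zero.1 h.symm).resolve_left ?_
  exact_mod_cast (Equiv.Perm.sign (Tuple.sort f)).ne_zero

/-- Vectors whose exterior product is a multiple of the basis vector of `I` are supported on `I`. -/
lemma apply_eq_zero_of_plucker {r : ℕ} {v : Fin r → Fin n → ℂ} {I : Fin r ↪o Fin n}
    (hv : ∀ K, K ≠ I → pluckerVector v K = 0) (hI : pluckerVector v I ≠ 0) {j : Fin n}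
    (hj : j ∉ Set.range I) (a : Fin r) : v a j = 0 := by
  let B : Matrix (Fin r) (Fin r) ℂ := Matrix.of fun a b => v a (I b)
  -- By Cramer's rule, column `j` times the minor of `I` is a combination of the columns of `I` with
  -- coefficients the minors in which one column is replaced by column `j`; all of these vanish.
  have hcr : Matrix.cramer B (fun a => v a j) = 0 := by
    funext i
    rw [Matrix.cramer_apply]
    have hupd : B.updateCol i (fun a => v a j) =
        Matrix.of fun a c => v a (Function.update I i j c) := by
      ext a c
      rw [Matrix.updateCol_apply, Matrix.of_apply, Function.update_apply]
      split_ifs <;> rfl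
    rw [hupd]
    refine minor_eq_zero hv (b := i) ?_ (by rwa [Function.update_self])
    intro c d hcd
    simp only [Function.update_apply] at hcd
    split_ifs at hcd with h1 h2 h2
    · rw [h1, h2]
    · exact absurd ⟨d, hcd.symm⟩ hj
    · exact absurd ⟨c, hcd⟩ hj
    · exact I.injective hcd
  have h := Matrix.mulVec_cramer B (fun a => v a j)
  rw [hcr, Matrix.mulVec_zero] at h
  exact congrFun ((smul_eq_zero.1 h.symm).resolve_left hI) a

lemma support_of_isPluckerPoint {r : ℕ} {W : Submodule ℂ (Fin n → ℂ)} {I : Fin r ↪o Fin n}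
    (h : IsPluckerPoint W (coordinatePoint I)) :
    (∀ w ∈ W, ∀ j ∉ Set.range I, w j = 0) ∧ ∀ a, ∃ w ∈ W, w (I a) ≠ 0 := by
  obtain ⟨v, h0, heq⟩ := h
  have hK := (mk_eq_coordinatePoint_iff h0).1 heq.symm
  have hI : pluckerVector (fun a => (v a : Fin n → ℂ)) I ≠ 0 := fun hI =>
    h0 (funext fun K => if h : K = I then h ▸ hI else hK K h)
  refine ⟨fun w hw j hj => ?_, fun a => ?_⟩
  · have hsum := congrArg (fun u : W => (u : Fin n → ℂ) j) (v.sum_repr ⟨w, hw⟩)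
    simp only [AddSubmonoidClass.coe_finsetSum, Finset.sum_apply, Submodule.coe_smul,
      Pi.smul_apply] at hsum
    rw [← hsum]
    refine Finset.sum_eq_zero fun a _ => ?_
    rw [apply_eq_zero_of_plucker hK hI hj a, smul_zero]
  · by_contra! hall
    exact hI (Matrix.det_eq_zero_of_column_eq_zero a fun b => hall _ (v b).2)

lemma pluckerVector_single_self {r : ℕ} (I : Fin r ↪o Fin n) :
    pluckerVector (fun a => (Pi.single (I a) 1 : Fin n → ℂ)) I = 1 := by
  rw [pluckerVector]
  convert Matrix.det_one (n := Fin r) (R := ℂ) using 2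
  ext a b
  rw [Matrix.of_apply, Matrix.one_apply, Pi.single_apply]
  exact if_congr (by rw [I.injective.eq_iff, eq_comm]) rfl rfl

lemma pluckerVector_single_of_ne {r : ℕ} {I K : Fin r ↪o Fin n} (hK : K ≠ I) :
    pluckerVector (fun a => (Pi.single (I a) 1 : Fin n → ℂ)) K = 0 := by
  obtain ⟨a, ha⟩ : ∃ a, I a ∉ Set.range K := by
    by_contra! hall
    apply hK
    have hsub : Finset.univ.image I ⊆ Finset.univ.image K := by
      intro j hj
      obtain ⟨a, -, rfl⟩ := Finset.mem_image.1 hj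
      obtain ⟨b, hb⟩ := hall a
      exact Finset.mem_image.2 ⟨b, Finset.mem_univ _, hb⟩
    have heq := Finset.eq_of_subset_of_card_le hsub (by
      rw [Finset.card_image_of_injective _ K.injective,
        Finset.card_image_of_injective _ I.injective])
    have hr : Set.range I = Set.range K := by
      rw [← Set.image_univ, ← Set.image_univ, ← Finset.coe_univ, ← Finset.coe_image,
        ← Finset.coe_image, heq]
    exact (DFunLike.coe_injective ((I.strictMono.range_inj K.strictMono).1 hr)).symm
  refine Matrix.det_eq_zero_of_row_eq_zero a fun b => ?_
  exact Pi.single_eq_of_ne (fun h => ha ⟨b, h⟩) _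

/-- The coordinate subspace spanned by the basis vectors of `I`. -/
def coordinateSubspace {r : ℕ} (I : Fin r ↪o Fin n) : Submodule ℂ (Fin n → ℂ) :=
  Submodule.span ℂ (Set.range fun a => (Pi.single (I a) 1 : Fin n → ℂ))

lemma linearIndependent_single {r : ℕ} (I : Fin r ↪o Fin n) :
    LinearIndependent ℂ fun a => (Pi.single (I a) 1 : Fin n → ℂ) := by
  have h := (Pi.basisFun ℂ (Fin n)).linearIndependent.comp I I.injective
  convert h using 1
  funext a
  simp

lemma isPluckerPoint_coordinateSubspace {r : ℕ} (I : Fin r ↪o Fin n) :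
    IsPluckerPoint (coordinateSubspace I) (coordinatePoint I) := by
  let v : Module.Basis (Fin r) ℂ (coordinateSubspace I) :=
    Module.Basis.span (linearIndependent_single I)
  have hv : (fun a => (v a : Fin n → ℂ)) = fun a => Pi.single (I a) 1 :=
    funext fun a =>
      congrArg Subtype.val (Module.Basis.span_apply (linearIndependent_single I) a)
  have h0 : pluckerVector (fun a => (v a : Fin n → ℂ)) ≠ 0 := fun h => by
    have hI := congrFun h I
    rw [hv, pluckerVector_single_self] at hI
    exact one_ne_zero hI
  refine ⟨v, h0, ((mk_eq_coordinatePoint_iff h0).2 fun K hK => ?_).symm⟩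
  rw [hv]
  exact pluckerVector_single_of_ne hK

/-- A subspace whose Plücker point is a coordinate point is supported on that index set and meets
each of its coordinates, so inclusion of subspaces forces inclusion of index sets; conversely,
coordinate subspaces form the flag. -/
lemma mem_flagVariety_iff (I : ∀ r : Set.Ioo 0 n, Fin r.1 ↪o Fin n) :
    (fun r => coordinatePoint (I r)) ∈ flagVariety n ↔
      ∀ r s, r ≤ s → Set.range (I r) ⊆ Set.range (I s) := by
  constructor
  · rintro ⟨V, hV⟩ r s hrs _ ⟨a, rfl⟩
    obtain ⟨w, hw, hwa⟩ := (support_of_isPluckerPoint (hV r)).2 a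
    by_contra hnot
    exact hwa ((support_of_isPluckerPoint (hV s)).1 w (V.mono hrs hw) _ hnot)
  · intro h
    refine ⟨⟨fun r => coordinateSubspace (I r), fun r s hrs => ?_, fun r => ?_⟩,
      fun r => isPluckerPoint_coordinateSubspace (I r)⟩
    · refine Submodule.span_mono ?_
      rintro _ ⟨a, rfl⟩
      obtain ⟨b, hb⟩ := h r s hrs ⟨a, rfl⟩
      exact ⟨b, by simp only [hb]⟩
    · rw [coordinateSubspace, finrank_span_eq_card (linearIndependent_single _), Fintype.card_fin]

/-! ### Nested sequences -/

section Nested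

variable (hlam : ∀ j : ℕ, 1 ≤ j → j < n → lam (j + 1) < lam j) {z : gcIndex n → ℝ}
include hlam

/-- The sequence of length `r` of a pattern is contained in the sequence of length `s`. -/
def NestedRows (lam : ℕ → ℕ) (z : gcIndex n → ℝ) (r s : ℕ) : Prop :=
  ∀ j, 1 ≤ j → j ≤ r → ∃ k, 1 ≤ k ∧ k ≤ s ∧ firstRow z (lam s) k = firstRow z (lam r) j

lemma range_patternSeq_subset_iff (hz : z ∈ patterns n lam) {r s : ℕ} (hr : r ≤ n)
    (hs : s ≤ n) :
    Set.range (patternSeq hlam hz r hr) ⊆ Set.range (patternSeq hlam hz s hs) ↔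
      NestedRows lam z r s := by
  constructor
  · intro h j h1 h2
    obtain ⟨b, hb⟩ := h ⟨⟨j - 1, by omega⟩, rfl⟩
    refine ⟨b.1 + 1, by omega, b.2, ?_⟩
    rw [← patternSeq_succ hlam hz hs b, hb, patternSeq_succ]
    simp only [Nat.sub_add_cancel h1]
  · rintro h _ ⟨a, rfl⟩
    obtain ⟨k, h1, h2, hk⟩ := h (a.1 + 1) (by omega) a.2
    refine ⟨⟨k - 1, by omega⟩, Fin.ext ?_⟩
    have e1 := patternSeq_succ hlam hz hs ⟨k - 1, by omega⟩
    have e2 := patternSeq_succ hlam hz hr a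
    simp only [Nat.sub_add_cancel h1] at e1
    omega

/-- Walk to the right along row `i`. If the entry differs from the one below it in its column, the
latter equals the right neighbour in row `i`. If that neighbour is below `lam s`, column `k` crosses
the level at row `i`; otherwise strictness of row `i - 1` passes the hypotheses on to column `k +
1`. The walk ends at the diagonal. -/
lemma exists_firstRow_eq (hz : z ∈ (patterns n lam).extremePoints ℝ) (hstrict : StrictRows z)
    {s i k : ℕ} (h1 : 1 ≤ k) (h2 : k ≤ i) (h3 : i ≤ n) (hs1 : 1 ≤ s)
    (hle : (lam s : ℝ) ≤ ent i k z) (hk : k = i ∨ ent (i - 1) k z ≠ ent i k z) :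
    ∃ j, 1 ≤ j ∧ j ≤ s ∧ firstRow z (lam s) j = i := by
  induction h2 using Nat.decreasingInduction with
  | self =>
    have hlt := hle.trans (ent_le_top hz.1 h1 le_rfl h3)
    have his : i ≤ s := by
      by_contra hlt'
      exact absurd (lam_lt hlam hs1 (not_le.1 hlt') h3) (not_lt.2 (Nat.cast_le.1 hlt))
    exact ⟨i, h1, his, le_antisymm ((firstRow_le_iff hz.1 h1 le_rfl h3 hlt).2 hle)
      (firstRow_mem hz.1 h1 h3 hlt).1⟩
  | of_succ k hki ih =>
    obtain ⟨i, rfl⟩ : ∃ i', i = i' + 1 := ⟨i - 1, by omega⟩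
    simp only [Nat.add_sub_cancel] at hk ih
    have hki' : k ≤ i := by omega
    have heq : ent i k z = ent (i + 1) (k + 1) z :=
      (ent_eq_or_eq hz h1 hki' h3).resolve_left (hk.resolve_left (by omega))
    rcases lt_or_ge (ent (i + 1) (k + 1) z) (lam s) with hlt | hge
    · have hle' := hle.trans (ent_le_top hz.1 h1 (by omega) h3)
      have hks : k ≤ s := by
        by_contra hlt'
        exact absurd (lam_lt hlam hs1 (not_le.1 hlt') (by omega))
          (not_lt.2 (Nat.cast_le.1 hle'))
      refine ⟨k, h1, hks, le_antisymm ((firstRow_le_iff hz.1 h1 (by omega) h3 hle').2 hle) ?_⟩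
      by_contra hnot
      have := (firstRow_le_iff hz.1 h1 hki' (by omega) hle').1 (by omega)
      linarith
    · refine ih (by omega) hge ?_
      by_cases hk1 : k + 1 = i + 1
      · exact Or.inl hk1
      · right
        have := hstrict i k h1 (by omega) (by omega)
        exact (this.trans_eq heq).ne

lemma nestedRows_of_strictRows (hz : z ∈ (patterns n lam).extremePoints ℝ)
    (hstrict : StrictRows z) {r s : ℕ} (hrs : r ≤ s) (hs : s ≤ n) : NestedRows lam z r s := by
  intro j h1 h2
  have ht := cast_lam_le hlam h1 h2 (hrs.trans hs)
  obtain ⟨ha, hb⟩ := firstRow_mem hz.1 h1 (by omega) ht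
  have hc := firstRow_le hz.1 h1 (by omega) ht
  refine exists_firstRow_eq hlam hz hstrict h1 ha hc (by omega)
    ((cast_lam_le hlam (by omega) hrs hs).trans hb) ?_
  by_cases hj : j = firstRow z (lam r) j
  · exact Or.inl hj
  · right
    have := (firstRow_le_iff hz.1 (i := firstRow z (lam r) j - 1) h1 (by omega) (by omega) ht).not.1
      (by omega)
    exact ((not_le.1 this).trans_le hb).ne

/-- Suppose the entries `j` and `j + 1` of a row share the value `lam (r + 1)`. By nesting, column
`j` reaches `lam r` in a row where some column `k ≤ j + 1` first reaches `lam (r + 1)`, hence no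
later than the given row; but `lam r` exceeds the entry. -/
lemma strictRows_of_nestedRows (hz : z ∈ (patterns n lam).extremePoints ℝ)
    (hnest : ∀ r, 1 ≤ r → r + 1 < n → NestedRows lam z r (r + 1)) : StrictRows z := by
  have hnest' : ∀ r, 1 ≤ r → r + 1 ≤ n → NestedRows lam z r (r + 1) := by
    intro r hr hrn
    rcases hrn.lt_or_eq with h | h
    · exact hnest r hr h
    -- The sequence of length `n` contains every row, since all entries are at least `lam n`.
    · intro j h1 h2
      have ht := cast_lam_le hlam h1 h2 (by omega)
      have ha := (firstRow_mem hz.1 h1 (by omega) ht).1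
      have hc := firstRow_le hz.1 h1 (by omega) ht
      set k := firstRow z (lam r) j
      have ht' : (lam (r + 1) : ℝ) ≤ lam k := cast_lam_le hlam (by omega) (by omega) hrn
      refine ⟨k, by omega, by omega, le_antisymm ?_ (firstRow_mem hz.1 (by omega) hc ht').1⟩
      rw [firstRow_le_iff hz.1 (by omega) le_rfl hc ht', h]
      exact lam_le_ent hlam hz.1 (by omega) le_rfl hc
  -- Passing from length `r` to `r + 1` inserts one member, so positions move up by at most one. The
  -- induction descends from the last position, where the bound is the length.
  have hshift : ∀ r, r + 1 ≤ n → ∀ j, j ≤ r → 1 ≤ j →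
      ∃ k, 1 ≤ k ∧ k ≤ j + 1 ∧ firstRow z (lam (r + 1)) k = firstRow z (lam r) j := by
    intro r hrn j hjr
    induction hjr using Nat.decreasingInduction with
    | self => exact fun h1 => hnest' r h1 hrn r h1 le_rfl
    | of_succ j hj ih =>
      intro h1
      obtain ⟨k', hk1', hk', heq'⟩ := ih (by omega)
      obtain ⟨k, hk1, hk, heq⟩ := hnest' r (by omega) hrn j h1 (by omega)
      refine ⟨k, hk1, ?_, heq⟩
      by_contra hlt
      have hlt1 := firstRow_lt hlam hz.1 h1 (Nat.lt_succ_self j) hj (by omega)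
      rcases (show k' ≤ k by omega).eq_or_lt with rfl | hlt2
      · simp only [Nat.succ_eq_add_one] at hlt1
        omega
      · have := firstRow_lt hlam hz.1 hk1' hlt2 hk hrn
        simp only [Nat.succ_eq_add_one] at hlt1
        omega
  intro i j h1 h2 h3
  refine lt_of_le_of_ne (ent_anti hz.1 h1 (by omega) h2 h3) fun heq => ?_
  obtain ⟨c, hjc, hcn, hc⟩ := exists_ent_eq_lam hz (by omega : 1 ≤ j + 1) h2 h3
  obtain ⟨r, rfl⟩ : ∃ r, c = r + 1 := ⟨c - 1, by omega⟩
  obtain ⟨k, hk1, hk, hkeq⟩ := hshift r hcn j (by omega) h1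
  have hj1 : firstRow z (lam (r + 1)) (j + 1) ≤ i :=
    (firstRow_le_iff hz.1 (by omega) h2 h3 (cast_lam_le hlam (by omega) hjc hcn)).2 hc.ge
  have hki : firstRow z (lam r) j ≤ i := by
    rw [← hkeq]
    rcases hk.eq_or_lt with rfl | hlt
    · exact hj1
    · exact (firstRow_lt hlam hz.1 hk1 hlt hjc hcn).le.trans hj1
  have := (firstRow_le_iff hz.1 h1 (by omega) h3
    (cast_lam_le hlam h1 (by omega : j ≤ r) (by omega))).1 hki
  rw [← heq, hc, Nat.cast_le] at this
  exact absurd (hlam r (by omega) (by omega)) (not_lt.2 this)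

theorem vertexPoint_mem_flagVariety_iff (hz : z ∈ (patterns n lam).extremePoints ℝ) :
    vertexPoint hlam hz.1 ∈ flagVariety n ↔ StrictRows z := by
  rw [show vertexPoint hlam hz.1 = fun r : Set.Ioo 0 n => coordinatePoint
    (patternSeq hlam hz.1 r.1 r.2.2.le) from rfl, mem_flagVariety_iff]
  simp only [range_patternSeq_subset_iff]
  constructor
  · intro h
    refine strictRows_of_nestedRows hlam hz fun r hr hrn => ?_
    exact h ⟨r, hr, by omega⟩ ⟨r + 1, by omega, hrn⟩ (Nat.le_succ r)
  · exact fun h r s hrs => nestedRows_of_strictRows hlam hz h hrs s.2.2.le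

end Nested

end GelfandCetlin

end

theorem mainTheorem11 (n : ℕ) (hn : 1 ≤ n) (lam : ℕ → ℕ)
    (hlam : ∀ j : ℕ, 1 ≤ j → j < n → lam (j + 1) < lam j) :
    (∀ z ∈ GelfandCetlin.vertices n lam, ∃ x, GelfandCetlin.X0Face n lam {z} = {x}) ∧
    GelfandCetlin.verticesOnFlag n lam =
      {z ∈ GelfandCetlin.vertices n lam |
        ∀ (i j : ℕ) (h1 : 1 ≤ j) (hji : j ≤ i) (hin : i + 2 ≤ n),
          ¬ GelfandCetlin.QuadrupleEquality z i j h1 hji hin} ∧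
    {z ∈ GelfandCetlin.vertices n lam |
        ∀ (i j : ℕ) (h1 : 1 ≤ j) (hji : j ≤ i) (hin : i + 2 ≤ n),
          ¬ GelfandCetlin.QuadrupleEquality z i j h1 hji hin} =
      GelfandCetlin.regularVertices n lam := by
  have hV := GelfandCetlin.vertices_eq hlam
  refine ⟨fun z hz => ?_, ?_, ?_⟩
  · rw [hV] at hz
    exact ⟨_, GelfandCetlin.X0Face_vertex hlam hz⟩
  · ext z
    refine and_congr_right fun hz => ?_
    rw [hV] at hz
    rw [← GelfandCetlin.strictRows_iff hlam hz.1,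
      ← GelfandCetlin.vertexPoint_mem_flagVariety_iff hlam hz, GelfandCetlin.X0Face_vertex hlam hz]
    simp only [Set.singleton_eq_singleton_iff, exists_eq_left']
  · ext z
    rw [GelfandCetlin.mem_regularVertices_iff hlam]
    refine and_congr_right fun hz => ?_
    rw [hV] at hz
    exact (GelfandCetlin.strictRows_iff hlam hz.1).symm
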